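/- **Setting.** Let $\mathcal X,\mathcal T$ be finite nonempty sets and let $Q_{Y|X}$, $Q_{Z|X}$ be memoryless channels from $\mathcal X$ to the legitimate receiver (output alphabet $\mathcal Y$) and to the eavesdropper (output alphabet $\mathcal Z$), given by conditional densities with respect to $\sigma$-finite measures $dy$, $dz$. (Finite $\mathcal Y,\mathcal Z$ with counting measure give discrete memoryless channels; $\mathcal Y=\mathcal Z=\mathbb R$ with Lebesgue measure includes the additive Gaussian channels.) Let $Q_{X|T}$ be a stochastic map from $\mathcal T$ to $\mathcal X$, and put $Q_{Y|T}(y|t)=\sum_x Q_{X|T}(x|t)Q_{Y|X}(y|x)$, and similarly $Q_{Z|T}$; $Q^n$ denotes the $n$-fold product channel. For a distribution $P$ on $\mathcal T$ let $I(P,Q_{Z|T})$ be the mutual information (natural logarithm) between the input and output of $Q_{Z|T}$ with input distribution $P$, and let $$\phi(s,Q_{Z|T},P)=\ln\int_{\mathcal Z}\Bigl(\sum_{t\in\mathcal T}P(t)\,Q_{Z|T}(z|t)^{1/(1-s)}\Bigr)^{1-s}dz .$$ **Construction.** For every $n$ let $\mathcal L_n,\mathcal M_n$ be finite nonempty sets,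 $\mu_{\mathrm{Alice},n}:\mathcal L_n\to\mathcal T^n$ a channel encoder, and $\mathcal F_n$ a nonempty set of maps $\mathcal L_n\to\mathcal M_n$ that is two-universal (for $F$ uniform on $\mathcal F_n$, $\Pr[F(\ell_1)=F(\ell_2)]\le 1/|\mathcal M_n|$ whenever $\ell_1\ne\ell_2$) and fiber-balanced ($|f^{-1}(m)|=|\mathcal L_n|/|\mathcal M_n|$ for all $f\in\mathcal F_n$, $m\in\mathcal M_n$). The message $M_n$ is uniform on $\mathcal M_n$, $F_n$ is uniform on $\mathcal F_n$ and independent of $M_n$. Given $F_n=f$ and $M_n=m$, draw $L_n$ uniformly from $f^{-1}(m)$, send $\mu_{\mathrm{Alice},n}(L_n)$ through $Q_{X|T}^n$, and transmit the resulting $X_n\in\mathcal X^n$; $Z_n$ is the output of $Q^n_{Z|X}$. If a channel decoder $\mu_{\mathrm{Bob},n}:\mathcal Y^n\to\mathcal L_n$ is given, the wiretap decoder for $f$ is $f\circ\mu_{\mathrm{Bob},n}$. **Capacity.** A sequence of stochastic encoders $\mathcal M_n\to\mathcal X^n$ and decoders $\mathcal Y^n\to\mathcal M_n$ achieves the rate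 $R$ if, for uniform messages, the error probability tends to $0$, $I(M_n;Z_n)\to0$, and $\liminf_n\frac1n\ln|\mathcal M_n|\ge R$. The wiretap capacity $C$ is the supremum of the rates $R>0$ that are achieved by some sequence of codes ($0$ if there are none). **Claims.** 1. For every $0<s\le\frac12$ the function $P\mapsto\phi(s,Q_{Z|T},P)$ has a maximizer on the probability distributions on $\mathcal T$, and for each maximizer $P_{1,s}$ and every $n$ $$I(M_n;Z_n|F_n)\le\frac{|\mathcal M_n|^s\exp\bigl(n\,\phi(s,Q_{Z|T},P_{1,s})\bigr)}{s\,|\mathcal L_n|^s}.$$ 2. $P\mapsto I(P,Q_{Z|T})$ has a maximizer. Let $P_{\max}$ be any maximizer and let $\delta>0$. If $\ln|\mathcal M_n|<\ln|\mathcal L_n|-n\bigl(I(P_{\max},Q_{Z|T})+\delta\bigr)$ for all sufficiently large $n$, then $I(M_n;Z_n|F_n)\to0$. 3. In the situation of 2, suppose in addition that $(P_{\max},Q_{X|T})$ attains the maximum of $I(T;Y)-I(T;Z)$ over all finite auxiliary alphabets, all distributions of $T$ and all stochastic maps from $T$ to $X$; that the channel code $(\mu_{\mathrm{Alice},n},\mu_{\mathrm{Bob},n})$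 has average error probability tending to $0$ over $Q_{Y|T}^n$ and satisfies $\liminf_n\frac1n\ln|\mathcal L_n|\ge I(P_{\max},Q_{Y|T})$; and that $\liminf_n\frac1n\bigl(\ln|\mathcal M_n|-\ln|\mathcal L_n|\bigr)\ge-\bigl(I(P_{\max},Q_{Z|T})+\delta'\bigr)$. Then there are $f_n\in\mathcal F_n$ such that the constructed wiretap codes with $F_n=f_n$ achieve the rate $C-\delta'$. (Thus hash families with $\delta'$ arbitrarily small give rates arbitrarily close to the wiretap capacity.) -/

import Mathlib

open MeasureTheory ProbabilityTheory Filter Topology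

noncomputable section

namespace Wiretap

/-- `W a` is a probability density on `B` with respect to the reference measure `ν`, for every
input letter `a`.  Counting measure on a finite set gives conditional probabilities (discrete
channels), Lebesgue measure on `ℝ` gives conditional probability densities. -/
structure IsChannel {A B : Type*} [MeasurableSpace B] (ν : Measure B) (W : A → B → ℝ) : Prop where
  nonneg : ∀ a b, 0 ≤ W a b
  measurable : ∀ a, Measurable (W a)
  integral_eq_one : ∀ a, ∫ b, W a b ∂ν = 1

/-- A stochastic map between finite alphabets: each row is a probability vector. -/
def IsStochastic {A B : Type*} [Fintype B] (V : A → B → ℝ) : Prop :=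
  ∀ a, V a ∈ stdSimplex ℝ B

/-- Discrete channels are channels with respect to counting measure. -/
theorem IsStochastic.isChannel {A B : Type*} [Fintype B] [MeasurableSpace B]
    [MeasurableSingletonClass B] {V : A → B → ℝ} (hV : IsStochastic V) :
    IsChannel Measure.count V where
  nonneg a b := (hV a).1 b
  measurable a := measurable_of_countable _
  integral_eq_one a := by rw [integral_count]; exact (hV a).2

/-- Additive Gaussian channels (amplitude `x a`, noise variance `v > 0`) are channels with respect
to Lebesgue measure. -/
theorem isChannel_gaussian {A : Type*} (x : A → ℝ) {v : NNReal} (hv : v ≠ 0) :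
    IsChannel volume (fun a => gaussianPDFReal (x a) v) where
  nonneg _ b := gaussianPDFReal_nonneg _ _ b
  measurable _ := measurable_gaussianPDFReal _ _
  integral_eq_one _ := integral_gaussianPDFReal_eq_one _ hv

/-- Concatenation: the output of `V` (on a finite alphabet) is sent through `W`. -/
def comp {A B C : Type*} [Fintype B] (V : A → B → ℝ) (W : B → C → ℝ) : A → C → ℝ :=
  fun a c => ∑ b, V a b * W b c

/-- The `n`-fold memoryless extension of a channel. -/
def memoryless {A B : Type*} (n : ℕ) (W : A → B → ℝ) : (Fin n → A) → (Fin n → B) → ℝ :=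
  fun a b => ∏ i, W (a i) (b i)

/-- The product reference measure on blocks of length `n`. -/
def blockMeasure {B : Type*} [MeasurableSpace B] (n : ℕ) (ν : Measure B) : Measure (Fin n → B) :=
  Measure.pi fun _ => ν

/-- The uniform distribution on a finite set. -/
def uniform (A : Type*) [Fintype A] : A → ℝ := fun _ => 1 / (Fintype.card A : ℝ)

/-- The mutual information `I(P, W)` (natural logarithm) between the input, with distribution `P`,
and the output of the channel `W` with densities with respect to `ν`. -/
def mutualInfo {A B : Type*} [Fintype A] [MeasurableSpace B] (ν : Measure B)
    (P : A → ℝ) (W : A → B → ℝ) : ℝ :=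
  ∑ a, P a * ∫ b, W a b * Real.log (W a b / ∑ a', P a' * W a' b) ∂ν

/-- The Gallager-type function `φ(s, W, P)`. -/
def phi {A B : Type*} [Fintype A] [MeasurableSpace B] (ν : Measure B)
    (s : ℝ) (W : A → B → ℝ) (P : A → ℝ) : ℝ :=
  Real.log (∫ b, (∑ a, P a * W a b ^ (1 / (1 - s))) ^ (1 - s) ∂ν)

/-- Average error probability of the decoder `dec` for a uniform message sent through `W`. -/
def errorProb {M B : Type*} [Fintype M] [MeasurableSpace B] (ν : Measure B)
    (W : M → B → ℝ) (dec : B → M) : ℝ :=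
  ∑ m, uniform M m * ∫ b in {b | dec b ≠ m}, W m b ∂ν

open scoped Classical in
/-- `F` is a (nonempty) family of two-universal hash functions: for `F` uniform on the family,
distinct points collide with probability at most `1 / |M|`. -/
def IsTwoUniversal {L M : Type*} [Fintype M] (F : Finset (L → M)) : Prop :=
  F.Nonempty ∧ ∀ x₁ x₂ : L, x₁ ≠ x₂ →
    ((F.filter fun f => f x₁ = f x₂).card : ℝ) / F.card ≤ 1 / (Fintype.card M : ℝ)

open scoped Classical in
/-- The fiber `f⁻¹(m)`. -/
def fiber {L M : Type*} [Fintype L] (f : L → M) (m : M) : Finset L :=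
  Finset.univ.filter fun l => f l = m

/-- All fibers of all hash functions of the family have `|L| / |M|` elements. -/
def IsBalanced {L M : Type*} [Fintype L] [Fintype M] (F : Finset (L → M)) : Prop :=
  ∀ f ∈ F, ∀ m : M,
    ((fiber f m).card : ℝ) = (Fintype.card L : ℝ) / (Fintype.card M : ℝ)

/-- The wiretap encoder built from the hash function `f`, the channel encoder `μ` and the
artificial channel `V` from `T` to `X`: given `m`, draw `l` uniformly from `f⁻¹(m)` and send
`μ l` through the memoryless extension of `V`. -/
def hashEncoder {T X L M : Type*} [Fintype L] {n : ℕ} (V : T → X → ℝ)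
    (μ : L → (Fin n → T)) (f : L → M) : M → (Fin n → X) → ℝ :=
  fun m x => ∑ l ∈ fiber f m, 1 / ((fiber f m).card : ℝ) * memoryless n V (μ l) x

/-- The information `I(M_n; Z_n)` leaked to the eavesdropper when a uniform message is encoded by
the stochastic encoder `enc` and sent over the memoryless channel `Q` to the eavesdropper. -/
def leakage {X Z M : Type*} [Fintype X] [Fintype M] [MeasurableSpace Z] {n : ℕ} (ν : Measure Z)
    (Q : X → Z → ℝ) (enc : M → (Fin n → X) → ℝ) : ℝ :=
  mutualInfo (blockMeasure n ν) (uniform M) (comp enc (memoryless n Q))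

/-- `I(M_n; Z_n | F_n)` for the hash construction, with `F_n` uniform on the family `F`. -/
def condLeakage {T X Z L M : Type*} [Fintype X] [Fintype L] [Fintype M] [MeasurableSpace Z]
    {n : ℕ} (ν : Measure Z) (V : T → X → ℝ) (Q : X → Z → ℝ) (μ : L → (Fin n → T))
    (F : Finset (L → M)) : ℝ :=
  ∑ f ∈ F, 1 / (F.card : ℝ) * leakage ν Q (hashEncoder V μ f)

/-- `liminf (1/n) ln |M n| ≥ R`. -/
def RateAtLeast (M : ℕ → Type*) [∀ n, Fintype (M n)] (R : ℝ) : Prop :=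
  ∀ r < R, ∀ᶠ n : ℕ in atTop, r < Real.log (Fintype.card (M n)) / n

/-- The sequence of wiretap codes `(enc n, dec n)` achieves the rate `R` in the strong sense:
vanishing average error probability for the receiver, vanishing (unnormalized) mutual information
for the eavesdropper, and asymptotic rate at least `R`. -/
def AchievesRate {X Y Z : Type*} [Fintype X] [MeasurableSpace Y] [MeasurableSpace Z]
    (νY : Measure Y) (νZ : Measure Z) (QY : X → Y → ℝ) (QZ : X → Z → ℝ)
    (M : ℕ → Type*) [∀ n, Fintype (M n)]
    (enc : ∀ n, M n → (Fin n → X) → ℝ) (dec : ∀ n, (Fin n → Y) → M n) (R : ℝ) : Prop :=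
  (∀ n, IsStochastic (enc n)) ∧
  (∀ n m, MeasurableSet (dec n ⁻¹' {m})) ∧
  Tendsto (fun n => errorProb (blockMeasure n νY) (comp (enc n) (memoryless n QY)) (dec n))
    atTop (𝓝 0) ∧
  Tendsto (fun n => leakage νZ QZ (enc n)) atTop (𝓝 0) ∧
  RateAtLeast M R

/-- A rate `R > 0` is achievable if some sequence of wiretap codes achieves it. -/
def Achievable {X Y Z : Type*} [Fintype X] [MeasurableSpace Y] [MeasurableSpace Z]
    (νY : Measure Y) (νZ : Measure Z) (QY : X → Y → ℝ) (QZ : X → Z → ℝ) (R : ℝ) : Prop :=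
  0 < R ∧ ∃ (k : ℕ → ℕ) (_ : ∀ n, 0 < k n)
    (enc : ∀ n, Fin (k n) → (Fin n → X) → ℝ) (dec : ∀ n, (Fin n → Y) → Fin (k n)),
    AchievesRate νY νZ QY QZ (fun n => Fin (k n)) enc dec R

/-- The wiretap capacity: the supremum of the achievable rates (`0` if there are none). -/
def capacity {X Y Z : Type*} [Fintype X] [MeasurableSpace Y] [MeasurableSpace Z]
    (νY : Measure Y) (νZ : Measure Z) (QY : X → Y → ℝ) (QZ : X → Z → ℝ) : ℝ :=
  sSup {R | Achievable νY νZ QY QZ R}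

/-- `(P, V)` attains the maximum of `I(T;Y) - I(T;Z)` over all finite auxiliary alphabets, all
distributions of `T` and all stochastic maps from `T` to `X`. -/
def AttainsWiretapMax {T X Y Z : Type*} [Fintype T] [Fintype X] [MeasurableSpace Y]
    [MeasurableSpace Z] (νY : Measure Y) (νZ : Measure Z) (QY : X → Y → ℝ) (QZ : X → Z → ℝ)
    (P : T → ℝ) (V : T → X → ℝ) : Prop :=
  ∀ (k : ℕ) (P' : Fin k → ℝ) (V' : Fin k → X → ℝ),
    P' ∈ stdSimplex ℝ (Fin k) → IsStochastic V' →
    mutualInfo νY P' (comp V' QY) - mutualInfo νZ P' (comp V' QZ) ≤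
      mutualInfo νY P (comp V QY) - mutualInfo νZ P (comp V QZ)

end Wiretap

end

namespace Wiretap

/-! ### Channels -/

/-! Secrecy. Fix an output block z and let w(l) be its density given the codeword of l, with uniform
average p. At z, the leakage averaged over the hash family is an average of w(l) log(a/p), where a
is the mean of w over the fiber through l. Concavity of log moves the average over hash functions
inside; two-universality bounds the mean of a by p + (|M|/|L|) w(l)
(`IsTwoUniversal.sum_fiberAvg_le`); then log(1+y) ≤ y^s/s and Hölder leave Gallager's function of
the uniform law on codewords (`sum_fiberAvg_mul_log_le`).

Whatever the code, this is at most the n-th power of the single-letter maximum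
(`IsChannel.gallagerFn_block_le`). The concave power v^(1-s) lies below its tangent at the product
of the optimal single-letter sums, and the linear term is integrated letter by letter with the
optimality conditions at the maximizer (`IsChannel.lintegral_gallager_deriv_le`). This gives claim
1. For claim 2, φ(s, P) ≤ s (I(P) + K s) with K independent of P (`IsChannel.phi_le`), so one small
fixed s makes the bound decay exponentially even though the maximizer of φ varies with s.

Rate. The construction attains every rate below I(T;Y) - I(T;Z) - δ', so claim 3 needs only the
converse, that the capacity is at most I(T;Y) - I(T;Z); the coding half of the capacity formula
plays no role. The converse is Fano's inequality together with Csiszár's sum argument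
(`IsWiretapBound.condEntropy_block_sub_le`). Outputs are general densities, so every information
quantity is expressed through entropies of the finite input alphabet, which are bounded by log |A|
and hence always integrable. -/

theorem comp_memoryless {A B C : Type*} [Fintype B] (V : A → B → ℝ) (W : B → C → ℝ) (n : ℕ) :
    comp (memoryless n V) (memoryless n W) = memoryless n (comp V W) := by
  classical
  funext a c
  simp only [comp, memoryless, ← Finset.prod_mul_distrib]
  rw [Fintype.prod_sum (fun i x => V (a i) x * W x (c i))]

section Channels

variable {A B C : Type*} [MeasurableSpace C] {ν : Measure C}

theorem IsChannel.integrable {W : A → C → ℝ} (hW : IsChannel ν W) (a : A) : Integrable (W a) ν :=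
  integrable_of_integral_eq_one (hW.integral_eq_one a)

theorem IsChannel.comp [Fintype B] {V : A → B → ℝ} {W : B → C → ℝ} (hV : IsStochastic V)
    (hW : IsChannel ν W) : IsChannel ν (comp V W) where
  nonneg a c := Finset.sum_nonneg fun b _ => mul_nonneg ((hV a).1 b) (hW.nonneg b c)
  measurable a := Finset.measurable_sum _ fun b _ => (hW.measurable b).const_mul _
  integral_eq_one a := by
    simp only [Wiretap.comp]
    rw [integral_finsetSum _ fun b _ => (hW.integrable b).const_mul _]
    simp only [integral_const_mul, hW.integral_eq_one, mul_one]
    exact (hV a).2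

theorem IsChannel.memoryless [SigmaFinite ν] {W : A → C → ℝ} (hW : IsChannel ν W) (n : ℕ) :
    IsChannel (blockMeasure n ν) (memoryless n W) where
  nonneg a c := Finset.prod_nonneg fun i _ => hW.nonneg _ _
  measurable a := Finset.measurable_prod _ fun i _ =>
    (hW.measurable _).comp (measurable_pi_apply i)
  integral_eq_one a := by
    simp only [Wiretap.memoryless, blockMeasure]
    rw [integral_fintype_prod_eq_prod (fun i => W (a i))]
    simp [hW.integral_eq_one]

theorem IsChannel.precomp {W : A → C → ℝ} (hW : IsChannel ν W) (g : B → A) :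
    IsChannel ν (fun b => W (g b)) where
  nonneg b := hW.nonneg (g b)
  measurable b := hW.measurable (g b)
  integral_eq_one b := hW.integral_eq_one (g b)

theorem IsStochastic.memoryless {X : Type*} [Fintype X] {V : A → X → ℝ} (hV : IsStochastic V)
    (n : ℕ) : IsStochastic (memoryless n V) := fun a =>
  ⟨fun x => Finset.prod_nonneg fun i _ => (hV _).1 _, by
    classical
    simp only [Wiretap.memoryless]
    rw [← Fintype.prod_sum (fun i x => V (a i) x)]
    exact Finset.prod_eq_one fun i _ => (hV _).2⟩

end Channels

/-! ### Entropy of nonnegative vectors -/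

section Entropy

variable {A : Type*} [Fintype A]

/-- `(∑ w) H(w / ∑ w)`, the homogeneous extension of Shannon's entropy to nonnegative vectors. -/
noncomputable def entropyFn (w : A → ℝ) : ℝ :=
  ∑ a, Real.negMulLog (w a) - Real.negMulLog (∑ a, w a)

theorem continuous_entropyFn : Continuous (entropyFn : (A → ℝ) → ℝ) := by
  unfold entropyFn
  fun_prop

theorem entropyFn_smul (c : ℝ) (w : A → ℝ) :
    entropyFn (fun a => c * w a) = c * entropyFn w := by
  simp only [entropyFn, ← Finset.mul_sum, Real.negMulLog_mul, Finset.sum_add_distrib,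
    ← Finset.sum_mul]
  ring

theorem entropyFn_eq_sum {w : A → ℝ} (hw : ∀ a, 0 ≤ w a) :
    entropyFn w = ∑ a, (∑ a', w a') * Real.negMulLog (w a / ∑ a', w a') := by
  rcases eq_or_ne (∑ a, w a) 0 with h | h
  · have h0 := (Finset.sum_eq_zero_iff_of_nonneg fun a _ => hw a).1 h
    simp only [entropyFn, h, Real.negMulLog_zero, sub_zero, zero_mul, Finset.sum_const_zero]
    exact Finset.sum_eq_zero fun a ha => by rw [h0 a ha, Real.negMulLog_zero]
  · have : (w : A → ℝ) = fun a => (∑ a', w a') * (w a / ∑ a', w a') := by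
      funext a; field_simp
    conv_lhs => rw [this, entropyFn_smul]
    rw [entropyFn, ← Finset.sum_div, div_self h, Real.negMulLog_one, sub_zero, Finset.mul_sum]

theorem entropyFn_nonneg {w : A → ℝ} (hw : ∀ a, 0 ≤ w a) : 0 ≤ entropyFn w := by
  rw [entropyFn_eq_sum hw]
  have hs : 0 ≤ ∑ a, w a := Finset.sum_nonneg fun a _ => hw a
  refine Finset.sum_nonneg fun a _ => mul_nonneg hs (Real.negMulLog_nonneg
    (div_nonneg (hw a) hs) (div_le_one_of_le₀ ?_ hs))
  exact Finset.single_le_sum (fun a _ => hw a) (Finset.mem_univ a)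

/-- Gibbs' inequality. -/
theorem entropyFn_le {w b : A → ℝ} (hw : ∀ a, 0 ≤ w a) (hb : ∀ a, 0 ≤ b a) (hb1 : ∑ a, b a ≤ 1)
    (hwb : ∀ a, b a = 0 → w a = 0) : entropyFn w ≤ ∑ a, w a * (-Real.log (b a)) := by
  set S := ∑ a, w a with hS
  have key : ∀ a, Real.negMulLog (w a) + w a * Real.log S - w a * (-Real.log (b a)) ≤
      S * b a - w a := by
    intro a
    rcases (hw a).eq_or_lt with h | h
    · rw [← h]; simp
      exact mul_nonneg (Finset.sum_nonneg fun a _ => hw a) (hb a)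
    · have hb' : 0 < b a := lt_of_le_of_ne (hb a) fun h' => h.ne' (hwb a h'.symm)
      have hSp : 0 < S := lt_of_lt_of_le h
        (Finset.single_le_sum (fun a _ => hw a) (Finset.mem_univ a))
      have h1 := Real.log_le_sub_one_of_pos (div_pos (mul_pos hSp hb') h)
      rw [Real.log_div (mul_pos hSp hb').ne' h.ne', Real.log_mul hSp.ne' hb'.ne'] at h1
      have h2 := mul_le_mul_of_nonneg_left h1 h.le
      have h3 : w a * (S * b a / w a - 1) = S * b a - w a := by field_simp
      rw [h3] at h2
      refine le_trans (le_of_eq ?_) h2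
      rw [Real.negMulLog]; ring
  have h := Finset.sum_le_sum fun a (_ : a ∈ Finset.univ) => key a
  rw [Finset.sum_sub_distrib, Finset.sum_sub_distrib, Finset.sum_add_distrib, ← Finset.sum_mul,
    ← Finset.mul_sum, ← hS] at h
  have hS0 : 0 ≤ S := Finset.sum_nonneg fun a _ => hw a
  have h4 : S * ∑ a, b a ≤ S := mul_le_of_le_one_right hS0 hb1
  rw [entropyFn, ← hS, Real.negMulLog]
  linarith

theorem entropyFn_le_log_card {w : A → ℝ} (hw : ∀ a, 0 ≤ w a) :
    entropyFn w ≤ (∑ a, w a) * Real.log (Fintype.card A) := by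
  rcases isEmpty_or_nonempty A with h | h
  · simp [entropyFn]
  have hc : (0 : ℝ) < Fintype.card A := by exact_mod_cast Fintype.card_pos
  refine (entropyFn_le (b := fun _ => 1 / (Fintype.card A : ℝ)) hw (fun _ => by positivity)
    (by simp) (fun a h => absurd h (by positivity))).trans (le_of_eq ?_)
  simp [Finset.sum_mul]

theorem entropyFn_of_mem_stdSimplex {P : A → ℝ} (hP : P ∈ stdSimplex ℝ A) :
    entropyFn P = ∑ a, Real.negMulLog (P a) := by
  simp [entropyFn, hP.2]

theorem le_one_of_mem_stdSimplex {P : A → ℝ} (hP : P ∈ stdSimplex ℝ A) (a : A) : P a ≤ 1 :=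
  hP.2 ▸ Finset.single_le_sum (fun a _ => hP.1 a) (Finset.mem_univ a)

theorem uniform_mem_stdSimplex [Nonempty A] : uniform A ∈ stdSimplex ℝ A :=
  ⟨fun _ => by unfold uniform; positivity, by simp [uniform]⟩

theorem entropyFn_uniform [Nonempty A] : entropyFn (uniform A) = Real.log (Fintype.card A) := by
  rw [entropyFn_of_mem_stdSimplex uniform_mem_stdSimplex]
  simp [uniform, Real.negMulLog]

end Entropy

/-! ### Mutual information -/

section MutualInfo

variable {A B : Type*} [Fintype A] [MeasurableSpace B] {ν : Measure B} {W : A → B → ℝ}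
  {P : A → ℝ}

theorem IsChannel.integrable_output (hW : IsChannel ν W) (P : A → ℝ) :
    Integrable (fun b => ∑ a, P a * W a b) ν :=
  integrable_finsetSum _ fun a _ => (hW.integrable a).const_mul _

theorem IsChannel.integral_output (hW : IsChannel ν W) (hP : P ∈ stdSimplex ℝ A) :
    ∫ b, ∑ a, P a * W a b ∂ν = 1 := by
  rw [integral_finsetSum _ fun a _ => (hW.integrable a).const_mul _]
  simp only [integral_const_mul, hW.integral_eq_one, mul_one]
  exact hP.2

theorem IsChannel.measurable_entropyFn (hW : IsChannel ν W) (P : A → ℝ) :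
    Measurable (fun b => entropyFn fun a => P a * W a b) :=
  continuous_entropyFn.measurable.comp
    (measurable_pi_lambda _ fun a => (hW.measurable a).const_mul _)

theorem IsChannel.integrable_entropyFn (hW : IsChannel ν W) (hP : ∀ a, 0 ≤ P a) :
    Integrable (fun b => entropyFn fun a => P a * W a b) ν := by
  refine ((hW.integrable_output P).mul_const (Real.log (Fintype.card A))).mono'
    (hW.measurable_entropyFn P).aestronglyMeasurable (ae_of_all _ fun b => ?_)
  have h : ∀ a, 0 ≤ P a * W a b := fun a => mul_nonneg (hP a) (hW.nonneg a b)
  rw [Real.norm_eq_abs, abs_of_nonneg (entropyFn_nonneg h)]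
  exact entropyFn_le_log_card h

/-- Bayes' rule, pointwise in the output: the density ratio is replaced by the posterior P w / p,
which lies in [0, 1], where `Real.negMulLog` is bounded. This makes the information density
integrable with no moment or entropy assumption on the channel. -/
theorem mul_log_ratio (hP : ∀ a, 0 ≤ P a) {w : A → ℝ} (hw : ∀ a, 0 ≤ w a) (a : A) :
    P a * (w a * Real.log (w a / ∑ a', P a' * w a')) = w a * Real.negMulLog (P a) -
      (∑ a', P a' * w a') * Real.negMulLog (P a * w a / ∑ a', P a' * w a') := by
  rcases (mul_nonneg (hP a) (hw a)).eq_or_lt with h | h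
  · rw [← mul_assoc, ← h]
    rcases mul_eq_zero.1 h.symm with h | h <;> simp [h]
  · have hs : 0 < ∑ a', P a' * w a' := lt_of_lt_of_le h
      (Finset.single_le_sum (fun a _ => mul_nonneg (hP a) (hw a)) (Finset.mem_univ a))
    have hPa : P a ≠ 0 := left_ne_zero_of_mul h.ne'
    have hwa : w a ≠ 0 := right_ne_zero_of_mul h.ne'
    rw [Real.negMulLog, Real.negMulLog, mul_div_assoc, Real.log_mul hPa (by positivity)]
    field_simp
    ring

theorem IsChannel.integrable_mul_log_ratio (hW : IsChannel ν W) (hP : ∀ a, 0 ≤ P a) (a : A) :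
    Integrable (fun b => P a * (W a b * Real.log (W a b / ∑ a', P a' * W a' b))) ν := by
  have hm : Measurable fun b => ∑ a', P a' * W a' b :=
    Finset.measurable_sum _ fun a _ => (hW.measurable a).const_mul _
  have h1 : ∀ b, P a * (W a b * Real.log (W a b / ∑ a', P a' * W a' b)) = W a b *
      Real.negMulLog (P a) -
      (∑ a', P a' * W a' b) * Real.negMulLog (P a * W a b / ∑ a', P a' * W a' b) := fun b =>
    mul_log_ratio hP (fun a => hW.nonneg a b) a
  simp only [h1]
  refine ((hW.integrable a).mul_const _).sub ((hW.integrable_output P).mul_bdd (c := 1) ?_ ?_)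
  · exact (Real.continuous_negMulLog.measurable.comp
      (((hW.measurable a).const_mul _).div hm)).aestronglyMeasurable
  · refine ae_of_all _ fun b => ?_
    have h0 : ∀ a, 0 ≤ P a * W a b := fun a => mul_nonneg (hP a) (hW.nonneg a b)
    have hs : 0 ≤ ∑ a', P a' * W a' b := Finset.sum_nonneg fun a _ => h0 a
    have hx0 : 0 ≤ P a * W a b / ∑ a', P a' * W a' b := div_nonneg (h0 a) hs
    have hx1 : P a * W a b / ∑ a', P a' * W a' b ≤ 1 :=
      div_le_one_of_le₀ (Finset.single_le_sum (fun a _ => h0 a) (Finset.mem_univ a)) hs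
    rw [Real.norm_eq_abs, abs_of_nonneg (Real.negMulLog_nonneg hx0 hx1)]
    have := Real.negMulLog_le_one_sub_self hx0
    linarith

theorem IsChannel.mutualInfo_eq_integral (hW : IsChannel ν W) (hP : ∀ a, 0 ≤ P a) :
    mutualInfo ν P W =
      ∫ b, ∑ a, P a * (W a b * Real.log (W a b / ∑ a', P a' * W a' b)) ∂ν := by
  -- The weight `P a` stays inside: without it the integrand need not be integrable when `P a = 0`.
  rw [integral_finsetSum _ fun a _ => hW.integrable_mul_log_ratio hP a]
  simp only [integral_const_mul, mutualInfo]

/-- `I(A;B) = H(A) - H(A|B)`. -/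
theorem IsChannel.mutualInfo_eq (hW : IsChannel ν W) (hP : P ∈ stdSimplex ℝ A) :
    mutualInfo ν P W = entropyFn P - ∫ b, entropyFn (fun a => P a * W a b) ∂ν := by
  have h1 : ∀ b, ∑ a, P a * (W a b * Real.log (W a b / ∑ a', P a' * W a' b)) =
      ∑ a, W a b * Real.negMulLog (P a) - entropyFn (fun a => P a * W a b) := fun b => by
    rw [entropyFn_eq_sum fun a => mul_nonneg (hP.1 a) (hW.nonneg a b), ← Finset.sum_sub_distrib]
    exact Finset.sum_congr rfl fun a _ => mul_log_ratio hP.1 (fun a => hW.nonneg a b) a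
  rw [hW.mutualInfo_eq_integral hP.1]
  simp only [h1]
  rw [integral_sub (integrable_finsetSum _ fun a _ => (hW.integrable a).mul_const _)
    (hW.integrable_entropyFn hP.1), integral_finsetSum _ fun a _ => (hW.integrable a).mul_const _]
  simp only [integral_mul_const, hW.integral_eq_one, one_mul, entropyFn_of_mem_stdSimplex hP]

theorem IsChannel.mutualInfo_nonneg (hW : IsChannel ν W) (hP : P ∈ stdSimplex ℝ A) :
    0 ≤ mutualInfo ν P W := by
  rw [hW.mutualInfo_eq hP, sub_nonneg, entropyFn_of_mem_stdSimplex hP]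
  have h1 : ∑ a, Real.negMulLog (P a) = ∫ b, ∑ a, W a b * Real.negMulLog (P a) ∂ν := by
    rw [integral_finsetSum _ fun a _ => (hW.integrable a).mul_const _]
    simp only [integral_mul_const, hW.integral_eq_one, one_mul]
  rw [h1]
  refine integral_mono (hW.integrable_entropyFn hP.1)
    (integrable_finsetSum _ fun a _ => (hW.integrable a).mul_const _) fun b => ?_
  refine (entropyFn_le (fun a => mul_nonneg (hP.1 a) (hW.nonneg a b)) hP.1 hP.2.le
    (fun a h => by simp [h])).trans (le_of_eq (Finset.sum_congr rfl fun a _ => ?_))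
  rw [Real.negMulLog]; ring

theorem IsChannel.continuousOn_mutualInfo (hW : IsChannel ν W) :
    ContinuousOn (fun P => mutualInfo ν P W) (stdSimplex ℝ A) := by
  have h : ContinuousOn (fun P : A → ℝ => entropyFn P -
      ∫ b, entropyFn (fun a => P a * W a b) ∂ν) (stdSimplex ℝ A) := by
    refine continuous_entropyFn.continuousOn.sub ?_
    refine continuousOn_of_dominated
      (bound := fun b => (∑ a, 1 * W a b) * Real.log (Fintype.card A))
      (fun P _ => (hW.measurable_entropyFn P).aestronglyMeasurable)
      (fun P hP => ae_of_all _ fun b => ?_) ((hW.integrable_output _).mul_const _)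
      (ae_of_all _ fun b => (continuous_entropyFn.comp (by fun_prop)).continuousOn)
    have h0 : ∀ a, 0 ≤ P a * W a b := fun a => mul_nonneg (hP.1 a) (hW.nonneg a b)
    rw [Real.norm_eq_abs, abs_of_nonneg (entropyFn_nonneg h0)]
    refine (entropyFn_le_log_card h0).trans
      (mul_le_mul_of_nonneg_right (Finset.sum_le_sum fun a _ => ?_) (Real.log_natCast_nonneg _))
    exact mul_le_mul_of_nonneg_right (le_one_of_mem_stdSimplex hP a) (hW.nonneg a b)
  exact h.congr fun P hP => hW.mutualInfo_eq hP

theorem IsChannel.exists_isMaxOn_mutualInfo [Nonempty A] (hW : IsChannel ν W) :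
    ∃ P ∈ stdSimplex ℝ A, IsMaxOn (fun P => mutualInfo ν P W) (stdSimplex ℝ A) P :=
  (isCompact_stdSimplex ℝ A).exists_isMaxOn ⟨_, uniform_mem_stdSimplex⟩
    hW.continuousOn_mutualInfo

end MutualInfo

/-! ### Gallager's function -/

/-- A concave power lies below its tangent at u: Bernoulli's inequality for v / u. -/
theorem rpow_le_tangent {q u v : ℝ} (hq0 : 0 < q) (hq1 : q ≤ 1) (hu : 0 < u) (hv : 0 ≤ v) :
    v ^ q ≤ u ^ q + q * u ^ (q - 1) * (v - u) := by
  have h := rpow_one_add_le_one_add_mul_self (s := (v - u) / u) (p := q)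
    (by rw [le_div_iff₀ hu]; linarith) hq0.le hq1
  have h1 : 1 + (v - u) / u = v / u := by field_simp; ring
  rw [h1, Real.div_rpow hv hu.le, div_le_iff₀ (by positivity)] at h
  refine h.trans (le_of_eq ?_)
  rw [Real.rpow_sub_one hu.ne']
  field_simp

/-- In `ENNReal` the tangent bound survives at u = 0, where the slope u^(q-1) is ⊤. No separate
treatment of outputs on which the optimal sum vanishes is then needed. -/
theorem ofReal_rpow_le_tangent {q u v : ℝ} (hq0 : 0 < q) (hq1 : q < 1) (hu : 0 ≤ u)
    (hv : 0 ≤ v) :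
    ENNReal.ofReal v ^ q ≤ ENNReal.ofReal (1 - q) * ENNReal.ofReal u ^ q +
      ENNReal.ofReal q * (ENNReal.ofReal v * ENNReal.ofReal u ^ (q - 1)) := by
  rcases hv.eq_or_lt with rfl | hv'
  · simp [hq0]
  rcases hu.eq_or_lt with rfl | hu'
  · have h0 : ENNReal.ofReal v ≠ 0 := by simpa using hv'
    have h1 : ENNReal.ofReal q ≠ 0 := by simpa using hq0
    rw [ENNReal.ofReal_zero, ENNReal.zero_rpow_of_neg (by linarith : q - 1 < 0), ENNReal.mul_top h0,
      ENNReal.mul_top h1, add_top]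
    exact le_top
  · rw [ENNReal.ofReal_rpow_of_pos hu', ENNReal.ofReal_rpow_of_pos hu',
      ENNReal.ofReal_rpow_of_pos hv', ← ENNReal.ofReal_mul hv, ← ENNReal.ofReal_mul hq0.le,
      ← ENNReal.ofReal_mul (by linarith), ← ENNReal.ofReal_add
        (mul_nonneg (by linarith) (by positivity)) (by positivity)]
    refine ENNReal.ofReal_le_ofReal ((rpow_le_tangent hq0 hq1.le hu' hv).trans (le_of_eq ?_))
    rw [Real.rpow_sub_one hu'.ne']
    field_simp
    ring

/-- Tonelli, one coordinate at a time. Extended values matter: the factors to be integrated contain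
negative powers that may be ⊤. -/
theorem lintegral_pi_prod {B : Type*} [MeasurableSpace B] (ν : Measure B) [SigmaFinite ν] {n : ℕ}
    {f : Fin n → B → ENNReal} (hf : ∀ i, Measurable (f i)) :
    ∫⁻ z, ∏ i, f i (z i) ∂(blockMeasure n ν) = ∏ i, ∫⁻ z, f i z ∂ν := by
  induction n with
  | zero => simp [blockMeasure]
  | succ n ih =>
    have h := (measurePreserving_piFinSuccAbove (fun _ : Fin (n + 1) => ν) 0).symm
    rw [blockMeasure, ← h.lintegral_comp_emb (MeasurableEquiv.measurableEmbedding _)]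
    simp only [MeasurableEquiv.piFinSuccAbove_symm_apply, Fin.prod_univ_succ, Fin.insertNthEquiv,
      Equiv.coe_fn_mk, Fin.zero_succAbove, Fin.insertNth_zero,
      Fin.cons_zero, Fin.cons_succ]
    have h2 := lintegral_prod_mul (μ := ν) (ν := Measure.pi fun _ : Fin n => ν) (f := f 0)
      (g := fun z => ∏ i : Fin n, f i.succ (z i)) (hf 0).aemeasurable
      (Finset.measurable_prod _ fun i _ =>
        (hf i.succ).comp (measurable_pi_apply i)).aemeasurable
    exact h2.trans (congrArg _ (ih fun i => hf i.succ))

section Gallager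

variable {A B : Type*} [Fintype A] [MeasurableSpace B] {ν : Measure B} {W : A → B → ℝ}
  {P : A → ℝ} {s : ℝ}

/-- The exponential of `phi`. -/
noncomputable def gallagerFn (ν : Measure B) (s : ℝ) (W : A → B → ℝ) (P : A → ℝ) : ℝ :=
  ∫ b, (∑ a, P a * W a b ^ (1 / (1 - s))) ^ (1 - s) ∂ν

theorem IsChannel.measurable_gallager (hW : IsChannel ν W) (s : ℝ) (P : A → ℝ) :
    Measurable fun b => (∑ a, P a * W a b ^ (1 / (1 - s))) ^ (1 - s) :=
  (Finset.measurable_sum _ fun a _ => ((hW.measurable a).pow_const _).const_mul _).pow_const _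

/-- Each w a is replaced by the total mass. The majorant does not depend on P, so it serves for
integrability and for dominated convergence in P. -/
theorem gallager_le_sum (hs1 : s < 1) (hP : P ∈ stdSimplex ℝ A) {w : A → ℝ}
    (hw : ∀ a, 0 ≤ w a) : (∑ a, P a * w a ^ (1 / (1 - s))) ^ (1 - s) ≤ ∑ a, 1 * w a := by
  simp only [one_mul]
  have hS : 0 ≤ ∑ a, w a := Finset.sum_nonneg fun a _ => hw a
  have h1 : ∑ a, P a * w a ^ (1 / (1 - s)) ≤ (∑ a, w a) ^ (1 / (1 - s)) := by
    calc _ ≤ ∑ a, P a * (∑ a, w a) ^ (1 / (1 - s)) := Finset.sum_le_sum fun a _ =>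
          mul_le_mul_of_nonneg_left (Real.rpow_le_rpow (hw a)
            (Finset.single_le_sum (fun a _ => hw a) (Finset.mem_univ a))
            (one_div_nonneg.2 (by linarith))) (hP.1 a)
      _ = _ := by rw [← Finset.sum_mul, hP.2, one_mul]
  refine (Real.rpow_le_rpow (Finset.sum_nonneg fun a _ => mul_nonneg (hP.1 a)
    (Real.rpow_nonneg (hw a) _)) h1 (by linarith)).trans (le_of_eq ?_)
  rw [← Real.rpow_mul hS, one_div_mul_cancel (by linarith), Real.rpow_one]

theorem IsChannel.gallager_base_nonneg (hW : IsChannel ν W) (hP : ∀ a, 0 ≤ P a) (s : ℝ) (b : B) :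
    0 ≤ ∑ a, P a * W a b ^ (1 / (1 - s)) :=
  Finset.sum_nonneg fun a _ => mul_nonneg (hP a) (Real.rpow_nonneg (hW.nonneg a b) _)

theorem IsChannel.integrable_gallager (hW : IsChannel ν W) (hs1 : s < 1)
    (hP : P ∈ stdSimplex ℝ A) :
    Integrable (fun b => (∑ a, P a * W a b ^ (1 / (1 - s))) ^ (1 - s)) ν := by
  refine (hW.integrable_output fun _ => 1).mono'
    (hW.measurable_gallager s P).aestronglyMeasurable (ae_of_all _ fun b => ?_)
  rw [Real.norm_eq_abs, abs_of_nonneg (Real.rpow_nonneg (hW.gallager_base_nonneg hP.1 s b) _)]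
  exact gallager_le_sum hs1 hP fun a => hW.nonneg a b

/-- Power means with exponent 1/(1-s) ≥ 1. Positivity is what allows the logarithm in `phi` to be
dropped when maximizing. -/
theorem IsChannel.one_le_gallagerFn (hW : IsChannel ν W) (hs0 : 0 < s) (hs1 : s < 1)
    (hP : P ∈ stdSimplex ℝ A) : 1 ≤ gallagerFn ν s W P := by
  rw [← hW.integral_output hP]
  refine integral_mono (hW.integrable_output P) (hW.integrable_gallager hs1 hP) fun b => ?_
  have h1 : (1 : ℝ) ≤ 1 / (1 - s) := by rw [le_div_iff₀ (by linarith)]; linarith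
  have h2 := Real.rpow_arith_mean_le_arith_mean_rpow Finset.univ P (fun a => W a b)
    (fun a _ => hP.1 a) hP.2 (fun a _ => hW.nonneg a b) h1
  have h0 : 0 ≤ ∑ a, P a * W a b :=
    Finset.sum_nonneg fun a _ => mul_nonneg (hP.1 a) (hW.nonneg a b)
  have h3 := Real.rpow_le_rpow (Real.rpow_nonneg h0 _) h2 (by linarith : 0 ≤ 1 - s)
  rwa [← Real.rpow_mul h0, one_div_mul_cancel (by linarith), Real.rpow_one] at h3

theorem IsChannel.continuousOn_gallagerFn (hW : IsChannel ν W) (hs1 : s < 1) :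
    ContinuousOn (gallagerFn ν s W) (stdSimplex ℝ A) := by
  refine continuousOn_of_dominated (bound := fun b => ∑ a, 1 * W a b)
    (fun P _ => (hW.measurable_gallager s P).aestronglyMeasurable)
    (fun P hP => ae_of_all _ fun b => ?_) (hW.integrable_output _)
    (ae_of_all _ fun b => Continuous.continuousOn ?_)
  · rw [Real.norm_eq_abs, abs_of_nonneg (Real.rpow_nonneg (hW.gallager_base_nonneg hP.1 s b) _)]
    exact gallager_le_sum hs1 hP fun a => hW.nonneg a b
  · exact Continuous.rpow_const (by fun_prop) fun _ => Or.inr (by linarith)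

theorem IsChannel.isMaxOn_phi_iff (hW : IsChannel ν W) (hs0 : 0 < s) (hs1 : s < 1)
    (hP : P ∈ stdSimplex ℝ A) :
    IsMaxOn (phi ν s W) (stdSimplex ℝ A) P ↔ IsMaxOn (gallagerFn ν s W) (stdSimplex ℝ A) P := by
  have h : ∀ P ∈ stdSimplex ℝ A, 0 < gallagerFn ν s W P := fun P hP =>
    zero_lt_one.trans_le (hW.one_le_gallagerFn hs0 hs1 hP)
  simp only [isMaxOn_iff]
  exact forall₂_congr fun P' hP' => Real.log_le_log_iff (h P' hP') (h P hP)

theorem IsChannel.exists_isMaxOn_phi [Nonempty A] (hW : IsChannel ν W) (hs0 : 0 < s)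
    (hs1 : s < 1) : ∃ P ∈ stdSimplex ℝ A, IsMaxOn (phi ν s W) (stdSimplex ℝ A) P := by
  obtain ⟨P, hP, hmax⟩ := (isCompact_stdSimplex ℝ A).exists_isMaxOn ⟨_, uniform_mem_stdSimplex⟩
    (hW.continuousOn_gallagerFn hs1)
  exact ⟨P, hP, (hW.isMaxOn_phi_iff hs0 hs1 hP).2 hmax⟩

/-- The optimality conditions at a maximizer of Gallager's function. -/
theorem IsChannel.lintegral_gallager_deriv_le (hW : IsChannel ν W) (hs0 : 0 < s) (hs1 : s < 1)
    (hP : P ∈ stdSimplex ℝ A) (hmax : IsMaxOn (gallagerFn ν s W) (stdSimplex ℝ A) P) (a : A) :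
    ∫⁻ b, ENNReal.ofReal (W a b ^ (1 / (1 - s))) *
      ENNReal.ofReal (∑ a', P a' * W a' b ^ (1 / (1 - s))) ^ (1 - s - 1) ∂ν ≤
      ENNReal.ofReal (gallagerFn ν s W P) := by
  classical
  set α : B → ℝ := fun b => ∑ a', P a' * W a' b ^ (1 / (1 - s)) with hα
  set x : B → ℝ := fun b => W a b ^ (1 / (1 - s)) with hx
  have hα0 : ∀ b, 0 ≤ α b := hW.gallager_base_nonneg hP.1 s
  have hx0 : ∀ b, 0 ≤ x b := fun b => Real.rpow_nonneg (hW.nonneg a b) _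
  have hxm : Measurable x := (hW.measurable a).pow_const _
  have hαm : Measurable α :=
    Finset.measurable_sum _ fun a _ => ((hW.measurable a).pow_const _).const_mul _
  set q := 1 - s with hq
  have hq0 : 0 < q := by linarith
  have hq1 : q < 1 := by linarith
  set ψ := gallagerFn ν s W P with hψ
  have hψ0 : 0 ≤ ψ := zero_le_one.trans (hW.one_le_gallagerFn hs0 hs1 hP)
  set y : ℝ → B → ℝ := fun ε b => (1 - ε) * α b + ε * x b with hy
  -- moving from `P` towards the point mass at `a`
  have bound : ∀ ε ∈ Set.Ioo (0 : ℝ) 1,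
      ∫⁻ b, ENNReal.ofReal (x b) * ENNReal.ofReal (y ε b) ^ (q - 1) ∂ν ≤
        ENNReal.ofReal (ψ * (1 - ε) ^ (q - 1)) := by
    rintro ε ⟨hε0, hε1⟩
    have hε1' : 0 < 1 - ε := by linarith
    set Pε : A → ℝ := (1 - ε) • P + ε • (Pi.single a 1) with hPε
    have hPεmem : Pε ∈ stdSimplex ℝ A :=
      convex_stdSimplex ℝ A hP (single_mem_stdSimplex ℝ a) hε1'.le hε0.le (by ring)
    have hyP : ∀ b, y ε b = ∑ a', Pε a' * W a' b ^ (1 / q) := fun b => by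
      simp only [hPε, hy, hα, hx, Pi.add_apply, Pi.smul_apply, smul_eq_mul, add_mul,
        Finset.sum_add_distrib, mul_assoc, ← Finset.mul_sum]
      simp [Pi.single_apply]
    have hyi : Integrable (fun b => y ε b ^ q) ν := by
      simp only [hyP]; exact hW.integrable_gallager hs1 hPεmem
    have hyψ : ∫ b, y ε b ^ q ∂ν ≤ ψ := by
      simp only [hyP]; exact hmax hPεmem
    have hαi : Integrable (fun b => ((1 - ε) * α b) ^ q) ν := by
      simp only [Real.mul_rpow hε1'.le (hα0 _)]
      exact (hW.integrable_gallager hs1 hP).const_mul _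
    have hαψ : ∫ b, ((1 - ε) * α b) ^ q ∂ν = (1 - ε) ^ q * ψ := by
      simp only [Real.mul_rpow hε1'.le (hα0 _)]
      rw [integral_const_mul]; rfl
    have hy0 : ∀ b, (1 - ε) * α b ≤ y ε b := fun b =>
      le_add_of_nonneg_right (mul_nonneg hε0.le (hx0 b))
    have hα0' : ∀ b, 0 ≤ (1 - ε) * α b := fun b => mul_nonneg hε1'.le (hα0 b)
    -- The tangent at y ε, evaluated at (1-ε) α, gives q ε x y^(q-1) ≤ y^q - ((1-ε) α)^q. Comparing
    -- with (1-ε) α rather than α keeps the difference nonnegative.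
    calc _ ≤ ∫⁻ b, ENNReal.ofReal ((y ε b ^ q - ((1 - ε) * α b) ^ q) / (q * ε)) ∂ν := by
          refine lintegral_mono fun b => ?_
          rcases (hx0 b).eq_or_lt with h | h
          · simp [← h]
          · have hyp : 0 < y ε b := add_pos_of_nonneg_of_pos (hα0' b) (mul_pos hε0 h)
            rw [ENNReal.ofReal_rpow_of_pos hyp, ← ENNReal.ofReal_mul h.le]
            refine ENNReal.ofReal_le_ofReal ?_
            rw [le_div_iff₀ (by positivity)]
            have := rpow_le_tangent hq0 hq1.le hyp (hα0' b)
            have h2 : (1 - ε) * α b - y ε b = - (ε * x b) := by simp only [hy]; ring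
            rw [h2] at this
            linarith
      _ = ENNReal.ofReal (∫ b, (y ε b ^ q - ((1 - ε) * α b) ^ q) / (q * ε) ∂ν) := by
          refine (ofReal_integral_eq_lintegral_ofReal ((hyi.sub hαi).div_const _) ?_).symm
          refine ae_of_all _ fun b => div_nonneg (sub_nonneg.2 ?_) (by positivity)
          exact Real.rpow_le_rpow (hα0' b) (hy0 b) hq0.le
      _ ≤ _ := by
          refine ENNReal.ofReal_le_ofReal ?_
          rw [integral_div, integral_sub hyi hαi, hαψ, div_le_iff₀ (by positivity)]
          -- Maximality leaves ψ (1 - (1-ε)^q), and the tangent of the power at 1-ε, evaluated at 1,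
          -- bounds this by ψ q ε (1-ε)^(q-1).
          have h1 := rpow_le_tangent hq0 hq1.le hε1' zero_le_one
          rw [Real.one_rpow] at h1
          have h2 := mul_le_mul_of_nonneg_left h1 hψ0
          linarith
  have hlim : ∀ b, Tendsto
      (fun ε => ENNReal.ofReal (x b) * ENNReal.ofReal (y ε b) ^ (q - 1)) (𝓝[>] 0)
      (𝓝 (ENNReal.ofReal (x b) * ENNReal.ofReal (α b) ^ (q - 1))) := fun b => by
    refine ENNReal.Tendsto.const_mul ?_ (Or.inr ENNReal.ofReal_ne_top)
    refine (ENNReal.continuous_rpow_const.tendsto _).comp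
      ((ENNReal.continuous_ofReal.tendsto _).comp ?_)
    have hc : Continuous fun ε : ℝ => y ε b := by simp only [hy]; fun_prop
    have := (hc.tendsto 0).mono_left (nhdsWithin_le_nhds (s := Set.Ioi 0))
    simpa [hy] using this
  have hlim2 : Tendsto (fun ε : ℝ => ENNReal.ofReal (ψ * (1 - ε) ^ (q - 1))) (𝓝[>] 0)
      (𝓝 (ENNReal.ofReal ψ)) := by
    refine (ENNReal.continuous_ofReal.tendsto _).comp ?_
    have hc : ContinuousAt (fun ε : ℝ => ψ * (1 - ε) ^ (q - 1)) 0 :=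
      continuousAt_const.mul (ContinuousAt.rpow_const (by fun_prop) (Or.inl (by norm_num)))
    have := hc.tendsto.mono_left (nhdsWithin_le_nhds (s := Set.Ioi 0))
    simpa using this
  -- Fatou as ε → 0. Where α vanishes and x does not, the limit is ⊤, so finiteness of the bound
  -- also shows that this set is null.
  calc _ = ∫⁻ b, liminf (fun ε => ENNReal.ofReal (x b) * ENNReal.ofReal (y ε b) ^ (q - 1))
          (𝓝[>] 0) ∂ν := lintegral_congr fun b => (hlim b).liminf_eq.symm
    _ ≤ liminf (fun ε => ∫⁻ b, ENNReal.ofReal (x b) * ENNReal.ofReal (y ε b) ^ (q - 1) ∂ν)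
          (𝓝[>] 0) := by
        refine lintegral_liminf_le fun ε => ?_
        have : Measurable (y ε) := (hαm.const_mul _).add (hxm.const_mul _)
        exact hxm.ennreal_ofReal.mul (this.ennreal_ofReal.pow_const _)
    _ ≤ liminf (fun ε : ℝ => ENNReal.ofReal (ψ * (1 - ε) ^ (q - 1))) (𝓝[>] 0) := by
        refine liminf_le_liminf ?_
        filter_upwards [Ioo_mem_nhdsGT (zero_lt_one' ℝ)] with ε hε using bound ε hε
    _ = _ := hlim2.liminf_eq

/-- Gallager's function of a memoryless extension is maximized by a product distribution. -/
theorem IsChannel.gallagerFn_block_le [SigmaFinite ν] (hW : IsChannel ν W) (hs0 : 0 < s)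
    (hs1 : s < 1) (hP : P ∈ stdSimplex ℝ A)
    (hmax : IsMaxOn (gallagerFn ν s W) (stdSimplex ℝ A) P) {L : Type*} [Fintype L] {n : ℕ}
    {c : L → ℝ} (hc : c ∈ stdSimplex ℝ L) (μ : L → (Fin n → A)) :
    gallagerFn (blockMeasure n ν) s (fun l => Wiretap.memoryless n W (μ l)) c ≤
      gallagerFn ν s W P ^ n := by
  have hψ0 : 0 ≤ gallagerFn ν s W P := zero_le_one.trans (hW.one_le_gallagerFn hs0 hs1 hP)
  set ψ := gallagerFn ν s W P with hψ
  set α : B → ℝ := fun b => ∑ a', P a' * W a' b ^ (1 / (1 - s)) with hα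
  have hα0 : ∀ b, 0 ≤ α b := hW.gallager_base_nonneg hP.1 s
  have hαm : Measurable α :=
    Finset.measurable_sum _ fun a _ => ((hW.measurable a).pow_const _).const_mul _
  have hx0 : ∀ a b, 0 ≤ W a b ^ (1 / (1 - s)) := fun a b => Real.rpow_nonneg (hW.nonneg a b) _
  have hxm : ∀ a, Measurable fun b => W a b ^ (1 / (1 - s)) := fun a =>
    (hW.measurable a).pow_const _
  have hWn := (hW.memoryless n).precomp μ
  have hq0 : 0 < 1 - s := by linarith
  have hαψ : ∫⁻ b, ENNReal.ofReal (α b) ^ (1 - s) ∂ν = ENNReal.ofReal ψ := by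
    rw [hψ, gallagerFn, ofReal_integral_eq_lintegral_ofReal (hW.integrable_gallager hs1 hP)
      (ae_of_all _ fun b => Real.rpow_nonneg (hα0 b) _)]
    exact lintegral_congr fun b => ENNReal.ofReal_rpow_of_nonneg (hα0 b) hq0.le
  have main : ∀ l, ∫⁻ z, ENNReal.ofReal (Wiretap.memoryless n W (μ l) z ^ (1 / (1 - s))) *
      ENNReal.ofReal (∏ i, α (z i)) ^ (1 - s - 1) ∂(blockMeasure n ν) ≤
      ENNReal.ofReal ψ ^ n := fun l => by
    have h1 : ∀ z : Fin n → B, ENNReal.ofReal (Wiretap.memoryless n W (μ l) z ^ (1 / (1 - s))) *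
        ENNReal.ofReal (∏ i, α (z i)) ^ (1 - s - 1) =
        ∏ i, (ENNReal.ofReal (W (μ l i) (z i) ^ (1 / (1 - s))) *
          ENNReal.ofReal (α (z i)) ^ (1 - s - 1)) := fun z => by
      rw [Finset.prod_mul_distrib, Wiretap.memoryless, ← Real.finsetProd_rpow _ _
        (fun i _ => hW.nonneg _ _), ENNReal.ofReal_prod_of_nonneg fun i _ => hx0 _ _,
        ENNReal.ofReal_prod_of_nonneg fun i _ => hα0 _,
        ENNReal.prod_rpow_of_ne_top fun i _ => ENNReal.ofReal_ne_top]
    simp only [h1]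
    rw [lintegral_pi_prod ν (f := fun i b => ENNReal.ofReal (W (μ l i) b ^ (1 / (1 - s))) *
          ENNReal.ofReal (α b) ^ (1 - s - 1)) fun i =>
          (hxm _).ennreal_ofReal.mul (hαm.ennreal_ofReal.pow_const _)]
    refine (Finset.prod_le_prod' fun i _ =>
      hW.lintegral_gallager_deriv_le hs0 hs1 hP hmax (μ l i)).trans (le_of_eq ?_)
    simp [hψ]
  have hαn : ∫⁻ z, ENNReal.ofReal (∏ i, α (z i)) ^ (1 - s) ∂(blockMeasure n ν) =
      ENNReal.ofReal ψ ^ n := by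
    have h1 : ∀ z : Fin n → B, ENNReal.ofReal (∏ i, α (z i)) ^ (1 - s) =
        ∏ i, ENNReal.ofReal (α (z i)) ^ (1 - s) := fun z => by
      rw [ENNReal.ofReal_prod_of_nonneg fun i _ => hα0 _,
        ENNReal.prod_rpow_of_ne_top fun i _ => ENNReal.ofReal_ne_top]
    simp only [h1]
    rw [lintegral_pi_prod ν (f := fun _ b => ENNReal.ofReal (α b) ^ (1 - s))
      fun i => hαm.ennreal_ofReal.pow_const _]
    simp [hαψ]
  have hαnm : Measurable fun z : Fin n → B => ENNReal.ofReal (∏ i, α (z i)) :=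
    (Finset.measurable_prod _ fun i _ => hαm.comp (measurable_pi_apply i)).ennreal_ofReal
  have hMm : ∀ l, Measurable fun z =>
      ENNReal.ofReal (Wiretap.memoryless n W (μ l) z ^ (1 / (1 - s))) := fun l =>
    ((hWn.measurable l).pow_const _).ennreal_ofReal
  refine (ENNReal.ofReal_le_ofReal_iff (pow_nonneg hψ0 n)).1 ?_
  rw [gallagerFn, ofReal_integral_eq_lintegral_ofReal (hWn.integrable_gallager hs1 hc)
      (ae_of_all _ fun b => Real.rpow_nonneg (hWn.gallager_base_nonneg hc.1 s b) _),
      ENNReal.ofReal_pow hψ0]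
  -- Tangent at u = ∏ α(z i), the value for the optimal product distribution. The constant term
  -- integrates to s ψ^n, and each codeword contributes at most (1-s) ψ^n times its weight.
  calc _ ≤ ∫⁻ z, (ENNReal.ofReal s * ENNReal.ofReal (∏ i, α (z i)) ^ (1 - s) +
        ENNReal.ofReal (1 - s) * ∑ l, ENNReal.ofReal (c l) *
          (ENNReal.ofReal (Wiretap.memoryless n W (μ l) z ^ (1 / (1 - s))) *
            ENNReal.ofReal (∏ i, α (z i)) ^ (1 - s - 1))) ∂(blockMeasure n ν) := by
        refine lintegral_mono fun z => ?_
        rw [← ENNReal.ofReal_rpow_of_nonneg (hWn.gallager_base_nonneg hc.1 s z) hq0.le]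
        refine (ofReal_rpow_le_tangent (u := ∏ i, α (z i)) hq0 (by linarith)
          (Finset.prod_nonneg fun i _ => hα0 (z i))
          (hWn.gallager_base_nonneg hc.1 s z)).trans (le_of_eq ?_)
        rw [ENNReal.ofReal_sum_of_nonneg fun l _ => mul_nonneg (hc.1 l)
          (Real.rpow_nonneg (hWn.nonneg l z) _), Finset.sum_mul, sub_sub_cancel]
        simp only [ENNReal.ofReal_mul (hc.1 _), mul_assoc]
    _ = ENNReal.ofReal s * ENNReal.ofReal ψ ^ n + ENNReal.ofReal (1 - s) *
        ∑ l, ENNReal.ofReal (c l) * ∫⁻ z, ENNReal.ofReal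
          (Wiretap.memoryless n W (μ l) z ^ (1 / (1 - s))) *
            ENNReal.ofReal (∏ i, α (z i)) ^ (1 - s - 1) ∂(blockMeasure n ν) := by
        have hm : ∀ l, Measurable fun z => ENNReal.ofReal
          (Wiretap.memoryless n W (μ l) z ^ (1 / (1 - s))) *
            ENNReal.ofReal (∏ i, α (z i)) ^ (1 - s - 1) := fun l =>
          (hMm l).mul (hαnm.pow_const _)
        rw [lintegral_add_left ((hαnm.pow_const _).const_mul _),
          lintegral_const_mul _ (hαnm.pow_const _), hαn,
          lintegral_const_mul _ (Finset.measurable_sum _ fun l _ => (hm l).const_mul _),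
          lintegral_finsetSum _ fun l _ => (hm l).const_mul _]
        simp only [lintegral_const_mul _ (hm _)]
    _ ≤ ENNReal.ofReal s * ENNReal.ofReal ψ ^ n + ENNReal.ofReal (1 - s) *
        ∑ l, ENNReal.ofReal (c l) * ENNReal.ofReal ψ ^ n := by
        gcongr with l
        exact main l
    _ = _ := by
        rw [← Finset.sum_mul, ← ENNReal.ofReal_sum_of_nonneg fun l _ => hc.1 l, hc.2,
          ENNReal.ofReal_one, one_mul, ← add_mul, ← ENNReal.ofReal_add hs0.le hq0.le]
        simp

/-! ### Gallager's function for small parameters -/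

theorem exp_le_one_add_add_sq (y : ℝ) :
    Real.exp y ≤ 1 + y + y ^ 2 * (1 + Real.exp y) := by
  have h1 : Real.exp y - 1 ≤ y * Real.exp y := by
    have h := Real.add_one_le_exp (-y)
    have h2 := mul_le_mul_of_nonneg_right h (Real.exp_pos y).le
    rw [← Real.exp_add, neg_add_cancel, Real.exp_zero] at h2
    linarith
  have h3 := Real.add_one_le_exp y
  have h4 := Real.exp_pos y
  rcases le_total 0 y with h | h
  · nlinarith [mul_le_mul_of_nonneg_left h1 h, sq_nonneg y]
  · nlinarith [mul_nonneg (neg_nonneg.2 h) (by linarith : 0 ≤ Real.exp y - 1 - y), sq_nonneg y,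
      mul_nonneg (sq_nonneg y) h4.le]

/-- The second-order remainder of r^(1+u) in u, dominated uniformly in u. For r ≤ 1 use √r |log r| ≤
2, for r ≥ 1 use log r ≤ 4 r^(1/4). A bound quadratic in r suffices because second moments of the
likelihood ratio are controlled. -/
theorem mul_log_sq_le {r u : ℝ} (hr : 0 < r) (hu0 : 0 ≤ u) (hu1 : u ≤ 1 / 2) :
    r * Real.log r ^ 2 * (1 + r ^ u) ≤ 32 * (1 + r ^ 2) := by
  rcases le_total r 1 with h | h
  · have h1 := Real.abs_log_mul_self_rpow_lt r (1 / 2) hr h (by norm_num)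
    have h2 : (Real.log r * r ^ (1 / 2 : ℝ)) ^ 2 ≤ 4 := by
      rw [← sq_abs]
      calc _ ≤ (1 / (1 / 2) : ℝ) ^ 2 := by gcongr
        _ = 4 := by norm_num
    rw [mul_pow, ← Real.sqrt_eq_rpow, Real.sq_sqrt hr.le] at h2
    have h3 : r ^ u ≤ 1 := Real.rpow_le_one hr.le h hu0
    have h4 : 0 ≤ r ^ u := Real.rpow_nonneg hr.le _
    nlinarith [sq_nonneg r, mul_nonneg hr.le (sq_nonneg (Real.log r))]
  · have h1 := Real.log_le_rpow_div hr.le (by norm_num : (0 : ℝ) < 1 / 4)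
    have h2 : Real.log r ^ 2 ≤ 16 * r ^ (1 / 2 : ℝ) := by
      calc _ ≤ (r ^ (1 / 4 : ℝ) / (1 / 4)) ^ 2 := by
            have := Real.log_nonneg h
            gcongr
        _ = _ := by
            rw [div_pow, ← Real.rpow_natCast, ← Real.rpow_mul hr.le]
            norm_num; ring
    have h3 : r ^ u ≤ r ^ (1 / 2 : ℝ) := Real.rpow_le_rpow_of_exponent_le h hu1
    have h4 : (1 : ℝ) ≤ r ^ (1 / 2 : ℝ) := Real.one_le_rpow h (by norm_num)
    have h5 : r ^ (1 / 2 : ℝ) * r ^ (1 / 2 : ℝ) = r := by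
      rw [← Real.rpow_add hr]; norm_num
    calc _ ≤ r * (16 * r ^ (1 / 2 : ℝ)) * (r ^ (1 / 2 : ℝ) + r ^ (1 / 2 : ℝ)) := by gcongr
      _ = 32 * r * (r ^ (1 / 2 : ℝ) * r ^ (1 / 2 : ℝ)) := by ring
      _ = 32 * r ^ 2 := by rw [h5]; ring
      _ ≤ _ := by linarith

theorem rpow_one_add_le {r u : ℝ} (hr : 0 ≤ r) (hu0 : 0 ≤ u) (hu1 : u ≤ 1 / 2) :
    r ^ (1 + u) ≤ r + u * (r * Real.log r) + 32 * u ^ 2 * (1 + r ^ 2) := by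
  rcases hr.eq_or_lt with rfl | hr'
  · rw [Real.zero_rpow (by linarith)]
    simp; positivity
  rw [Real.rpow_add hr', Real.rpow_one]
  have h1 := exp_le_one_add_add_sq (Real.log r * u)
  rw [← Real.rpow_def_of_pos hr'] at h1
  have h2 := mul_le_mul_of_nonneg_left h1 hr
  have h3 := mul_le_mul_of_nonneg_left (mul_log_sq_le hr' hu0 hu1) (sq_nonneg u)
  nlinarith

/-- Dividing by the output density p reduces the claim to a second-order expansion in u = s/(1-s) of
a power mean of the ratios r = w / p. The remainder must be uniform in P, because the maximizer of φ
depends on s. -/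
theorem gallager_le_linear (hs0 : 0 < s) (hs1 : s ≤ 1 / 3) (hP : P ∈ stdSimplex ℝ A) {w : A → ℝ}
    (hw : ∀ a, 0 ≤ w a) :
    (∑ a, P a * w a ^ (1 / (1 - s))) ^ (1 - s) ≤ ∑ a, P a * w a +
      s * ∑ a, P a * (w a * Real.log (w a / ∑ a', P a' * w a')) +
      64 * s ^ 2 * (∑ a, P a * w a + ∑ a, 1 * w a) := by
  set p := ∑ a, P a * w a with hp
  simp only [one_mul]
  have hPw : ∀ a, 0 ≤ P a * w a := fun a => mul_nonneg (hP.1 a) (hw a)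
  have hp0 : 0 ≤ p := Finset.sum_nonneg fun a _ => hPw a
  have hS0 : 0 ≤ ∑ a, w a := Finset.sum_nonneg fun a _ => hw a
  have hq : 0 < 1 - s := by linarith
  rcases hp0.eq_or_lt with h | h
  · have h0 : ∀ a, P a * w a = 0 := fun a =>
      (Finset.sum_eq_zero_iff_of_nonneg fun a _ => hPw a).1 (hp.symm.trans h.symm) a
        (Finset.mem_univ a)
    have h1 : ∑ a, P a * w a ^ (1 / (1 - s)) = 0 := Finset.sum_eq_zero fun a _ => by
      rcases mul_eq_zero.1 (h0 a) with h | h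
      · simp [h]
      · rw [h, Real.zero_rpow (one_div_pos.2 hq).ne', mul_zero]
    have h2 : ∑ a, P a * (w a * Real.log (w a / p)) = 0 := Finset.sum_eq_zero fun a _ => by
      rw [← mul_assoc, h0 a, zero_mul]
    rw [h1, h2, Real.zero_rpow hq.ne', ← h]
    positivity
  -- The bound s ≤ 1/3 yields u ≤ 1/2 and u ≤ 2 s, so the remainder (1-s) 32 u² = 32 s u is at most
  -- 64 s².
  set u := s / (1 - s) with hu
  have hu0 : 0 ≤ u := by positivity
  have hu1 : u ≤ 1 / 2 := by rw [hu, div_le_iff₀ hq]; linarith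
  have hu2 : u ≤ 2 * s := by rw [hu, div_le_iff₀ hq]; nlinarith
  have hqu : (1 - s) * u = s := by rw [hu]; field_simp
  have hexp : 1 / (1 - s) = 1 + u := by rw [hu]; field_simp; ring
  set r : A → ℝ := fun a => w a / p with hr
  have hr0 : ∀ a, 0 ≤ r a := fun a => div_nonneg (hw a) hp0
  have hwr : ∀ a, w a = p * r a := fun a => by simp only [hr]; field_simp
  have hPr : ∑ a, P a * r a = 1 := by
    simp only [hr, ← mul_div_assoc, ← Finset.sum_div]; exact div_self h.ne'
  have hPr1 : ∀ a, P a * r a ≤ 1 := fun a =>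
    hPr ▸ Finset.single_le_sum (fun a _ => mul_nonneg (hP.1 a) (hr0 a)) (Finset.mem_univ a)
  set S := ∑ a, P a * r a ^ (1 + u) with hS
  have hSnn : 0 ≤ S := Finset.sum_nonneg fun a _ =>
    mul_nonneg (hP.1 a) (Real.rpow_nonneg (hr0 a) _)
  have hlhs : (∑ a, P a * w a ^ (1 / (1 - s))) ^ (1 - s) = p * S ^ (1 - s) := by
    have h1 : ∑ a, P a * w a ^ (1 / (1 - s)) = p ^ (1 / (1 - s)) * S := by
      rw [hS, Finset.mul_sum, hexp]
      refine Finset.sum_congr rfl fun a _ => ?_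
      rw [hwr a, Real.mul_rpow hp0 (hr0 a)]; ring
    rw [h1, Real.mul_rpow (Real.rpow_nonneg hp0 _) hSnn, ← Real.rpow_mul hp0,
      one_div_mul_cancel hq.ne', Real.rpow_one]
  have hS1 : S ^ (1 - s) ≤ 1 + (1 - s) * (S - 1) := by
    simpa using rpow_le_tangent hq (by linarith) one_pos hSnn
  have hS2 : S ≤ 1 + u * ∑ a, P a * (r a * Real.log (r a)) +
      32 * u ^ 2 * (1 + ∑ a, P a * r a ^ 2) := by
    calc S ≤ ∑ a, P a * (r a + u * (r a * Real.log (r a)) + 32 * u ^ 2 * (1 + r a ^ 2)) :=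
          Finset.sum_le_sum fun a _ =>
            mul_le_mul_of_nonneg_left (rpow_one_add_le (hr0 a) hu0 hu1) (hP.1 a)
      _ = ∑ a, P a * r a + u * ∑ a, P a * (r a * Real.log (r a)) +
          32 * u ^ 2 * (∑ a, P a + ∑ a, P a * r a ^ 2) := by
          simp only [Finset.mul_sum, ← Finset.sum_add_distrib]
          exact Finset.sum_congr rfl fun a _ => by ring
      _ = _ := by rw [hPr, hP.2]
  have hlog : ∑ a, P a * (w a * Real.log (r a)) = p * ∑ a, P a * (r a * Real.log (r a)) := by
    rw [Finset.mul_sum]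
    exact Finset.sum_congr rfl fun a _ => by rw [hwr a]; ring
  -- Uniformity in P: the posteriors P r are at most 1, so p P r² = w (P r) ≤ w.
  have hsq : p * ∑ a, P a * r a ^ 2 ≤ ∑ a, w a := by
    rw [Finset.mul_sum]
    refine Finset.sum_le_sum fun a _ => ?_
    calc p * (P a * r a ^ 2) = w a * (P a * r a) := by rw [hwr a]; ring
      _ ≤ w a := mul_le_of_le_one_right (hw a) (hPr1 a)
  set J := ∑ a, P a * (r a * Real.log (r a)) with hJ
  set K := ∑ a, P a * r a ^ 2 with hK
  have hK0 : 0 ≤ K := Finset.sum_nonneg fun a _ => mul_nonneg (hP.1 a) (sq_nonneg _)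
  rw [hlhs, hlog]
  have e1 : S ^ (1 - s) ≤ 1 + s * J + 64 * s ^ 2 * (1 + K) := by
    have h1 := mul_le_mul_of_nonneg_left hS2 hq.le
    have h2 : (1 - s) * (u * J) = s * J := by rw [← mul_assoc, hqu]
    have h3 : (1 - s) * (32 * u ^ 2 * (1 + K)) = 32 * s * u * (1 + K) := by
      linear_combination (32 * u * (1 + K)) * hqu
    have h4 : 32 * s * u * (1 + K) ≤ 32 * s * (2 * s) * (1 + K) := by gcongr
    nlinarith
  have e2 := mul_le_mul_of_nonneg_left e1 hp0
  have e3 : 64 * s ^ 2 * (p * K) ≤ 64 * s ^ 2 * ∑ a, w a := by gcongr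
  nlinarith

theorem IsChannel.phi_le (hW : IsChannel ν W) (hs0 : 0 < s) (hs1 : s ≤ 1 / 3)
    (hP : P ∈ stdSimplex ℝ A) :
    phi ν s W P ≤ s * (mutualInfo ν P W + 64 * (1 + Fintype.card A) * s) := by
  have h1 : gallagerFn ν s W P ≤ 1 + s * mutualInfo ν P W +
      64 * s ^ 2 * (1 + Fintype.card A) := by
    have i1 := hW.integrable_output P
    have i2 := hW.integrable_output fun _ => 1
    have i3 : Integrable (fun b => ∑ a, P a *
        (W a b * Real.log (W a b / ∑ a', P a' * W a' b))) ν :=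
      integrable_finsetSum _ fun a _ => hW.integrable_mul_log_ratio hP.1 a
    refine (integral_mono (hW.integrable_gallager (by linarith) hP)
      ((i1.add (i3.const_mul s)).add ((i1.add i2).const_mul (64 * s ^ 2)))
      fun b => gallager_le_linear hs0 hs1 hP fun a => hW.nonneg a b).trans (le_of_eq ?_)
    have e1 := integral_add (i1.add (i3.const_mul s)) ((i1.add i2).const_mul (64 * s ^ 2))
    have e2 := integral_add i1 (i3.const_mul s)
    have e3 := integral_add i1 i2
    have e4 : ∫ b, ∑ a, 1 * W a b ∂ν = Fintype.card A := by
      rw [integral_finsetSum _ fun a _ => (hW.integrable a).const_mul _]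
      simp [hW.integral_eq_one]
    refine e1.trans ?_
    simp only [Pi.add_apply]
    rw [integral_const_mul, e2, e3, integral_const_mul, e4, hW.integral_output hP, hW.mutualInfo_eq_integral hP.1]
  have h0 := hW.one_le_gallagerFn hs0 (by linarith) hP
  have h2 := Real.log_le_sub_one_of_pos (zero_lt_one.trans_le h0)
  change Real.log (gallagerFn ν s W P) ≤ _
  nlinarith

end Gallager

/-! ### Hashing -/

section Hashing

variable {L M : Type*} [Fintype L]

theorem sum_fiber [Fintype M] (f : L → M) (g : L → ℝ) :
    ∑ m, ∑ l ∈ fiber f m, g l = ∑ l, g l := by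
  classical
  rw [← Finset.sum_fiberwise Finset.univ f g]
  refine Finset.sum_congr rfl fun m _ => Finset.sum_congr ?_ fun _ _ => rfl
  ext l; simp [fiber]

theorem mem_fiber {f : L → M} {m : M} {l : L} : l ∈ fiber f m ↔ f l = m := by
  simp [fiber]

theorem IsBalanced.card_fiber_pos [Fintype M] [Nonempty L] [Nonempty M] {F : Finset (L → M)}
    (hF : IsBalanced F) {f : L → M} (hf : f ∈ F) (m : M) : (0 : ℝ) < (fiber f m).card := by
  rw [hF f hf m]
  have : 0 < Fintype.card L := Fintype.card_pos
  have : 0 < Fintype.card M := Fintype.card_pos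
  positivity

/-- The average of `w` over the fiber of `f` above `m`. -/
noncomputable def fiberAvg (f : L → M) (w : L → ℝ) (m : M) : ℝ :=
  ∑ l ∈ fiber f m, 1 / ((fiber f m).card : ℝ) * w l

theorem IsBalanced.fiberAvg_eq [Fintype M] {F : Finset (L → M)}
    (hF : IsBalanced F) {f : L → M} (hf : f ∈ F) (w : L → ℝ) (m : M) :
    fiberAvg f w m = (Fintype.card M : ℝ) / Fintype.card L * ∑ l ∈ fiber f m, w l := by
  rw [fiberAvg, ← Finset.mul_sum, hF f hf m, one_div_div]

/-- Balanced fibers make a uniform m followed by a uniform point of its fiber the same as a uniform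
l. -/
theorem IsBalanced.sum_uniform_mul_fiberAvg [Fintype M] [Nonempty M] {F : Finset (L → M)}
    (hF : IsBalanced F) {f : L → M} (hf : f ∈ F) (w : L → ℝ) (g : M → ℝ) :
    ∑ m, uniform M m * (fiberAvg f w m * g m) = ∑ l, uniform L l * (w l * g (f l)) := by
  rw [← sum_fiber f]
  refine Finset.sum_congr rfl fun m _ => ?_
  have hM : (Fintype.card M : ℝ) ≠ 0 := by exact_mod_cast Fintype.card_ne_zero
  rw [hF.fiberAvg_eq hf, uniform, Finset.mul_sum, Finset.sum_mul, Finset.mul_sum]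
  refine Finset.sum_congr rfl fun l hl => ?_
  rw [mem_fiber.1 hl, uniform]
  field_simp

/-- s log(1+y) = log (1+y)^s, and (1+y)^s ≤ 1 + y^s by subadditivity. -/
theorem log_one_add_le {y s : ℝ} (hy : 0 ≤ y) (hs0 : 0 < s) (hs1 : s ≤ 1) :
    Real.log (1 + y) ≤ y ^ s / s := by
  rw [le_div_iff₀ hs0, mul_comm, ← Real.log_rpow (by linarith)]
  have h1 : (1 + y) ^ s ≤ 1 + y ^ s := by
    have := NNReal.rpow_add_le_add_rpow (1 : NNReal) ⟨y, hy⟩ hs0.le hs1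
    rw [NNReal.one_rpow] at this
    exact_mod_cast this
  have h2 : 0 ≤ y ^ s := Real.rpow_nonneg hy s
  calc _ ≤ Real.log (1 + y ^ s) := Real.log_le_log (Real.rpow_pos_of_pos (by linarith) _) h1
    _ ≤ _ := by
      have := Real.log_le_sub_one_of_pos (by linarith : 0 < 1 + y ^ s)
      linarith

/-- Two-universality bounds the average over the hash functions of the mass of the fiber through a
given point. -/
theorem IsTwoUniversal.sum_fiberAvg_le [Fintype M] [Nonempty M] {F : Finset (L → M)}
    (hF : IsTwoUniversal F) (hbal : IsBalanced F) {w : L → ℝ} (hw : ∀ l, 0 ≤ w l) (l : L) :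
    ∑ f ∈ F, 1 / (F.card : ℝ) * fiberAvg f w (f l) ≤
      ∑ l', uniform L l' * w l' + (Fintype.card M : ℝ) / Fintype.card L * w l := by
  classical
  have hM : (Fintype.card M : ℝ) ≠ 0 := by exact_mod_cast Fintype.card_ne_zero
  have hFc : (F.card : ℝ) ≠ 0 := by exact_mod_cast (Finset.card_pos.2 hF.1).ne'
  -- A point collides with itself with probability 1; this diagonal term produces the excess over
  -- the uniform average.
  have hstep : ∀ l', w l' * (((F.filter fun f => f l' = f l).card : ℝ) / F.card) ≤
      1 / (Fintype.card M : ℝ) * w l' + if l' = l then w l else 0 := fun l' => by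
    by_cases h : l' = l
    · subst h
      have h1 : 0 ≤ 1 / (Fintype.card M : ℝ) * w l' :=
        mul_nonneg (by positivity) (hw l')
      simp [div_self hFc] at h1 ⊢
      exact h1
    · rw [if_neg h, add_zero, mul_comm]
      refine mul_le_mul_of_nonneg_right ?_ (hw l')
      convert hF.2 l' l h
  have hlhs : ∑ f ∈ F, 1 / (F.card : ℝ) * fiberAvg f w (f l) =
      (Fintype.card M : ℝ) / Fintype.card L *
        ∑ l', w l' * (((F.filter fun f => f l' = f l).card : ℝ) / F.card) := by
    have h1 : ∀ f ∈ F, 1 / (F.card : ℝ) * fiberAvg f w (f l) =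
        (Fintype.card M : ℝ) / Fintype.card L *
          ∑ l', w l' / F.card * (if f l' = f l then 1 else 0) := fun f hf => by
      have h2 : ∑ l' ∈ fiber f (f l), w l' = ∑ l', if f l' = f l then w l' else 0 := by
        rw [← Finset.sum_filter]
        refine Finset.sum_congr ?_ fun _ _ => rfl
        ext; simp [fiber]
      rw [hbal.fiberAvg_eq hf, h2, mul_left_comm, Finset.mul_sum]
      congr 1
      refine Finset.sum_congr rfl fun l' _ => ?_
      split_ifs <;> ring
    rw [Finset.sum_congr rfl h1, ← Finset.mul_sum, Finset.sum_comm]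
    congr 1
    refine Finset.sum_congr rfl fun l' _ => ?_
    rw [← Finset.mul_sum, Finset.sum_boole]
    ring
  rw [hlhs]
  refine (mul_le_mul_of_nonneg_left (Finset.sum_le_sum fun l' _ => hstep l')
    (by positivity)).trans (le_of_eq ?_)
  rw [Finset.sum_add_distrib, Finset.sum_ite_eq' Finset.univ l, if_pos (Finset.mem_univ l),
    mul_add, ← Finset.mul_sum, ← mul_assoc]
  simp only [uniform, ← Finset.mul_sum]
  field_simp

/-- Hölder with weights c w and exponent 1/(1-s), using 1 + s/(1-s) = 1/(1-s). -/
theorem sum_mul_rpow_le {s : ℝ} (hs0 : 0 < s) (hs1 : s < 1) {c w : L → ℝ} (hc : ∀ l, 0 ≤ c l)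
    (hw : ∀ l, 0 ≤ w l) :
    ∑ l, c l * (w l * w l ^ s) ≤
      (∑ l, c l * w l) ^ s * (∑ l, c l * w l ^ (1 / (1 - s))) ^ (1 - s) := by
  have hq : 0 < 1 - s := by linarith
  have h := Real.inner_le_weight_mul_Lp_of_nonneg Finset.univ (p := (1 - s)⁻¹)
    ((one_le_inv₀ hq).2 (by linarith)) (fun l => c l * w l) (fun l => w l ^ s)
    (fun l => mul_nonneg (hc l) (hw l)) (fun l => Real.rpow_nonneg (hw l) s)
  simp only [inv_inv, sub_sub_cancel] at h
  simp only [← mul_assoc]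
  refine h.trans (le_of_eq ?_)
  congr 3
  funext l
  rw [← Real.rpow_mul (hw l), mul_assoc]
  congr 1
  rcases (hw l).eq_or_lt with h0 | h0
  · rw [← h0, Real.zero_rpow (one_div_pos.2 hq).ne', zero_mul]
  · conv_lhs => rw [← Real.rpow_one (w l), ← Real.rpow_mul h0.le, one_mul, ← Real.rpow_add h0]
    congr 1
    field_simp
    ring

/-- Privacy amplification, for a single output letter. -/
theorem sum_fiberAvg_mul_log_le [Fintype M] [Nonempty L] [Nonempty M] {F : Finset (L → M)}
    (hF : IsTwoUniversal F) (hbal : IsBalanced F) {w : L → ℝ} (hw : ∀ l, 0 ≤ w l) {s : ℝ}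
    (hs0 : 0 < s) (hs1 : s < 1) :
    ∑ f ∈ F, 1 / (F.card : ℝ) * ∑ m, uniform M m *
      (fiberAvg f w m * Real.log (fiberAvg f w m / ∑ m', uniform M m' * fiberAvg f w m')) ≤
      (Fintype.card M : ℝ) ^ s / (s * (Fintype.card L : ℝ) ^ s) *
        (∑ l, uniform L l * w l ^ (1 / (1 - s))) ^ (1 - s) := by
  have hL0 : (0 : ℝ) < Fintype.card L := by exact_mod_cast Fintype.card_pos
  have hM0 : (0 : ℝ) < Fintype.card M := by exact_mod_cast Fintype.card_pos
  have hF0 : (0 : ℝ) < F.card := by exact_mod_cast Finset.card_pos.2 hF.1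
  have hu0 : ∀ l, 0 ≤ uniform L l := fun l => by unfold uniform; positivity
  have hup : ∀ l, 0 < uniform L l := fun l => by unfold uniform; positivity
  set p := ∑ l, uniform L l * w l with hp
  set κ := (Fintype.card M : ℝ) / Fintype.card L with hκ
  have hκ0 : 0 < κ := by positivity
  have hp0 : 0 ≤ p := Finset.sum_nonneg fun l _ => mul_nonneg (hu0 l) (hw l)
  have hout : ∀ f ∈ F, ∑ m', uniform M m' * fiberAvg f w m' = p := fun f hf => by
    simpa using hbal.sum_uniform_mul_fiberAvg hf w fun _ => 1
  have hpoint : ∀ l, w l * ∑ f ∈ F, 1 / (F.card : ℝ) * Real.log (fiberAvg f w (f l) / p) ≤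
      w l * ((κ * w l / p) ^ s / s) := fun l => by
    rcases (hw l).eq_or_lt with h0 | h0
    · simp [← h0]
    have hpp : 0 < p := lt_of_lt_of_le (mul_pos (hup l) h0)
      (Finset.single_le_sum (f := fun l => uniform L l * w l)
        (fun l _ => mul_nonneg (hu0 l) (hw l)) (Finset.mem_univ l))
    refine mul_le_mul_of_nonneg_left (le_trans ?_
      (log_one_add_le (y := κ * w l / p) (by positivity) hs0 hs1.le)) h0.le
    set c := 1 + κ * w l / p with hc
    have hcp : 0 < c := by positivity
    have hx : ∀ f ∈ F, 0 < fiberAvg f w (f l) / p := fun f hf => by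
      refine div_pos ?_ hpp
      rw [hbal.fiberAvg_eq hf]
      exact mul_pos hκ0 (lt_of_lt_of_le h0
        (Finset.single_le_sum (fun l _ => hw l) (mem_fiber.2 rfl)))
    have havg : ∑ f ∈ F, 1 / (F.card : ℝ) * (fiberAvg f w (f l) / p) ≤ c := by
      simp only [← mul_div_assoc, ← Finset.sum_div]
      rw [div_le_iff₀ hpp]
      refine (hF.sum_fiberAvg_le hbal hw l).trans (le_of_eq ?_)
      rw [← hp, ← hκ, hc, add_mul, one_mul, div_mul_cancel₀ _ hpp.ne']
    -- Jensen for log, through its tangent at c; only an upper bound c on the mean is needed.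
    calc _ ≤ ∑ f ∈ F, 1 / (F.card : ℝ) *
          (Real.log c + (fiberAvg f w (f l) / p / c - 1)) := by
          refine Finset.sum_le_sum fun f hf => mul_le_mul_of_nonneg_left ?_ (by positivity)
          have := Real.log_le_sub_one_of_pos (div_pos (hx f hf) hcp)
          rw [Real.log_div (hx f hf).ne' hcp.ne'] at this
          linarith
      _ = Real.log c + ((∑ f ∈ F, 1 / (F.card : ℝ) * (fiberAvg f w (f l) / p)) / c - 1) := by
          have h1 : ∑ _f ∈ F, 1 / (F.card : ℝ) = 1 := by
            rw [Finset.sum_const, nsmul_eq_mul]; field_simp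
          simp only [mul_add, mul_sub, mul_one, Finset.sum_add_distrib, Finset.sum_sub_distrib,
            ← Finset.sum_mul, h1, one_mul, Finset.sum_div, mul_div_assoc]
      _ ≤ _ := by
          have := (div_le_one hcp).2 havg
          linarith
  calc _ = ∑ f ∈ F, 1 / (F.card : ℝ) *
        ∑ l, uniform L l * (w l * Real.log (fiberAvg f w (f l) / p)) := by
        refine Finset.sum_congr rfl fun f hf => ?_
        rw [hout f hf, hbal.sum_uniform_mul_fiberAvg hf w
          fun m => Real.log (fiberAvg f w m / p)]
    _ = ∑ l, uniform L l *
        (w l * ∑ f ∈ F, 1 / (F.card : ℝ) * Real.log (fiberAvg f w (f l) / p)) := by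
        simp only [Finset.mul_sum]
        rw [Finset.sum_comm]
        exact Finset.sum_congr rfl fun l _ => Finset.sum_congr rfl fun f _ => by ring
    _ ≤ ∑ l, uniform L l * (w l * ((κ * w l / p) ^ s / s)) :=
        Finset.sum_le_sum fun l _ => mul_le_mul_of_nonneg_left (hpoint l) (hu0 l)
    _ = κ ^ s / s * ((∑ l, uniform L l * (w l * w l ^ s)) / p ^ s) := by
        rw [Finset.sum_div, Finset.mul_sum]
        refine Finset.sum_congr rfl fun l _ => ?_
        rw [Real.div_rpow (mul_nonneg hκ0.le (hw l)) hp0, Real.mul_rpow hκ0.le (hw l)]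
        ring
    _ ≤ κ ^ s / s * (∑ l, uniform L l * w l ^ (1 / (1 - s))) ^ (1 - s) := by
        refine mul_le_mul_of_nonneg_left ?_ (by positivity)
        refine div_le_of_le_mul₀ (Real.rpow_nonneg hp0 _) (Real.rpow_nonneg
          (Finset.sum_nonneg fun l _ => mul_nonneg (hu0 l) (Real.rpow_nonneg (hw l) _)) _) ?_
        rw [mul_comm _ (p ^ s)]
        exact sum_mul_rpow_le hs0 hs1 hu0 hw
    _ = _ := by
        rw [hκ, Real.div_rpow hM0.le hL0.le]
        congr 1
        field_simp

end Hashing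

/-! ### The hash encoder and its leakage -/

theorem comp_hashEncoder {T X L M B : Type*} [Fintype X] [Fintype L] {n : ℕ} (V : T → X → ℝ) (Q : X → B → ℝ) (μ : L → (Fin n → T))
    (f : L → M) (m : M) (z : Fin n → B) :
    comp (hashEncoder V μ f) (memoryless n Q) m z =
      fiberAvg f (fun l => memoryless n (comp V Q) (μ l) z) m := by
  rw [← comp_memoryless]
  simp only [comp, hashEncoder, fiberAvg, Finset.sum_mul, Finset.mul_sum]
  rw [Finset.sum_comm]
  exact Finset.sum_congr rfl fun l _ => Finset.sum_congr rfl fun x _ => by ring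

section Leakage

variable {T X Z L M : Type*} [Fintype X] [Fintype L] [Fintype M] [MeasurableSpace Z]
  {n : ℕ} {V : T → X → ℝ} {μ : L → (Fin n → T)} {F : Finset (L → M)}

theorem isStochastic_hashEncoder [Nonempty L] [Nonempty M] (hV : IsStochastic V)
    (hbal : IsBalanced F) {f : L → M} (hf : f ∈ F) : IsStochastic (hashEncoder V μ f) := by
  intro m
  have hpos := hbal.card_fiber_pos hf m
  refine ⟨fun x => Finset.sum_nonneg fun l _ =>
    mul_nonneg (by positivity) ((hV.memoryless n (μ l)).1 x), ?_⟩
  simp only [hashEncoder]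
  rw [Finset.sum_comm]
  simp only [← Finset.mul_sum, (hV.memoryless n (μ _)).2, Finset.sum_const, nsmul_eq_mul]
  field_simp

/-- The single-letter privacy amplification bound is applied at every output block and integrated.
What remains is Gallager's function of the uniform codeword law, and the block bound removes its
dependence on the code. -/
theorem condLeakage_le [Fintype T] [Nonempty L] [Nonempty M] {ν : Measure Z} [SigmaFinite ν]
    {Q : X → Z → ℝ} (hV : IsStochastic V) (hQ : IsChannel ν Q) (hF : IsTwoUniversal F)
    (hbal : IsBalanced F) {s : ℝ} (hs0 : 0 < s) (hs1 : s < 1) {P : T → ℝ}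
    (hP : P ∈ stdSimplex ℝ T) (hmax : IsMaxOn (phi ν s (comp V Q)) (stdSimplex ℝ T) P) :
    condLeakage ν V Q μ F ≤ (Fintype.card M : ℝ) ^ s * Real.exp (n * phi ν s (comp V Q) P) /
      (s * (Fintype.card L : ℝ) ^ s) := by
  have hW := hQ.comp hV
  have hWn := (hW.memoryless n).precomp μ
  have hmax' := (hW.isMaxOn_phi_iff hs0 hs1 hP).1 hmax
  have hch : ∀ f ∈ F, IsChannel (blockMeasure n ν)
      (comp (hashEncoder V μ f) (memoryless n Q)) := fun f hf =>
    (hQ.memoryless n).comp (isStochastic_hashEncoder hV hbal hf)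
  have hu : ∀ m, 0 ≤ uniform M m := (uniform_mem_stdSimplex (A := M)).1
  have hint : ∀ f ∈ F, Integrable (fun z => 1 / (F.card : ℝ) * ∑ m, uniform M m *
      (comp (hashEncoder V μ f) (memoryless n Q) m z *
        Real.log (comp (hashEncoder V μ f) (memoryless n Q) m z /
          ∑ m', uniform M m' * comp (hashEncoder V μ f) (memoryless n Q) m' z)))
      (blockMeasure n ν) := fun f hf =>
    (integrable_finsetSum _ fun m _ => (hch f hf).integrable_mul_log_ratio hu m).const_mul _
  have hexp : Real.exp (n * phi ν s (comp V Q) P) = gallagerFn ν s (comp V Q) P ^ n := by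
    rw [Real.exp_nat_mul]
    congr 1
    exact Real.exp_log (zero_lt_one.trans_le (hW.one_le_gallagerFn hs0 hs1 hP))
  calc condLeakage ν V Q μ F = ∫ z, ∑ f ∈ F, 1 / (F.card : ℝ) * ∑ m, uniform M m *
      (comp (hashEncoder V μ f) (memoryless n Q) m z *
        Real.log (comp (hashEncoder V μ f) (memoryless n Q) m z /
          ∑ m', uniform M m' * comp (hashEncoder V μ f) (memoryless n Q) m' z))
      ∂(blockMeasure n ν) := by
        rw [integral_finsetSum _ hint, condLeakage]
        refine Finset.sum_congr rfl fun f hf => ?_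
        rw [integral_const_mul, leakage, (hch f hf).mutualInfo_eq_integral hu]
    _ ≤ ∫ z, (Fintype.card M : ℝ) ^ s / (s * (Fintype.card L : ℝ) ^ s) *
        (∑ l, uniform L l * memoryless n (comp V Q) (μ l) z ^ (1 / (1 - s))) ^ (1 - s)
        ∂(blockMeasure n ν) := by
        refine integral_mono (integrable_finsetSum _ hint)
          ((hWn.integrable_gallager hs1 uniform_mem_stdSimplex).const_mul _) fun z => ?_
        simp only [comp_hashEncoder]
        exact sum_fiberAvg_mul_log_le hF hbal (fun l => hWn.nonneg l z) hs0 hs1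
    _ = (Fintype.card M : ℝ) ^ s / (s * (Fintype.card L : ℝ) ^ s) *
        gallagerFn (blockMeasure n ν) s (fun l => memoryless n (comp V Q) (μ l))
          (uniform L) := integral_const_mul _ _
    _ ≤ (Fintype.card M : ℝ) ^ s / (s * (Fintype.card L : ℝ) ^ s) *
        gallagerFn ν s (comp V Q) P ^ n :=
        mul_le_mul_of_nonneg_left
          (hW.gallagerFn_block_le hs0 hs1 hP hmax' uniform_mem_stdSimplex μ) (by positivity)
    _ = _ := by rw [hexp]; ring

theorem leakage_hashEncoder_nonneg [Nonempty L] [Nonempty M] {ν : Measure Z} [SigmaFinite ν]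
    {Q : X → Z → ℝ} (hV : IsStochastic V) (hQ : IsChannel ν Q) (hbal : IsBalanced F) {f : L → M}
    (hf : f ∈ F) : 0 ≤ leakage ν Q (hashEncoder V μ f) :=
  ((hQ.memoryless n).comp (isStochastic_hashEncoder hV hbal hf)).mutualInfo_nonneg
    uniform_mem_stdSimplex

theorem condLeakage_nonneg [Nonempty L] [Nonempty M] {ν : Measure Z} [SigmaFinite ν]
    {Q : X → Z → ℝ} (hV : IsStochastic V) (hQ : IsChannel ν Q) (hbal : IsBalanced F) :
    0 ≤ condLeakage ν V Q μ F :=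
  Finset.sum_nonneg fun _ hf =>
    mul_nonneg (by positivity) (leakage_hashEncoder_nonneg hV hQ hbal hf)

theorem exists_leakage_le_condLeakage {ν : Measure Z} {Q : X → Z → ℝ} (hF : F.Nonempty) :
    ∃ f ∈ F, leakage ν Q (hashEncoder V μ f) ≤ condLeakage ν V Q μ F := by
  obtain ⟨f, hf, hmin⟩ := F.exists_min_image (fun f => leakage ν Q (hashEncoder V μ f)) hF
  refine ⟨f, hf, ?_⟩
  have hF0 : (0 : ℝ) < F.card := by exact_mod_cast Finset.card_pos.2 hF
  calc leakage ν Q (hashEncoder V μ f)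
      = ∑ f' ∈ F, 1 / (F.card : ℝ) * leakage ν Q (hashEncoder V μ f) := by
        rw [Finset.sum_const, nsmul_eq_mul]; field_simp
    _ ≤ _ := Finset.sum_le_sum fun f' hf' =>
        mul_le_mul_of_nonneg_left (hmin f' hf') (by positivity)

end Leakage

/-! ### Conditional entropy given side information and a channel output -/

section CondEntropy

variable {A U X B : Type*} [MeasurableSpace U] [MeasurableSpace B]
  {ρ : Measure U} {ν : Measure B}

/-- `w a u x` is, for `a` and `x` fixed, a nonnegative integrable density in `u`. -/
structure IsJointDensity (ρ : Measure U) (w : A → U → X → ℝ) : Prop where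
  nonneg : ∀ a u x, 0 ≤ w a u x
  measurable : ∀ a x, Measurable fun u => w a u x
  integrable : ∀ a x, Integrable (fun u => w a u x) ρ

/-- The total mass of a joint density. -/
noncomputable def totalMass [Fintype A] [Fintype X] (ρ : Measure U) (w : A → U → X → ℝ) : ℝ :=
  ∑ a, ∑ x, ∫ u, w a u x ∂ρ

/-- The joint density of `a`, the side information `u` and the output of the channel `Q` with
input `x`. -/
def outputDensity [Fintype X] (Q : X → B → ℝ) (w : A → U → X → ℝ) : U × B → A → ℝ :=
  fun p a => ∑ x, w a p.1 x * Q x p.2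

/-- The conditional entropy `H(A|U,B)`, where `B` is the output of the channel `Q` and `w` is the
joint density of `A`, `U` and the channel input. -/
noncomputable def condEntropy [Fintype A] [Fintype X] (ρ : Measure U) (ν : Measure B)
    (Q : X → B → ℝ) (w : A → U → X → ℝ) : ℝ :=
  ∫ p, entropyFn (outputDensity Q w p) ∂(ρ.prod ν)

variable [Fintype X] {Q : X → B → ℝ} {w : A → U → X → ℝ}

theorem IsJointDensity.measurable_outputDensity (hw : IsJointDensity ρ w) (hQ : IsChannel ν Q)
    (a : A) : Measurable fun p => outputDensity Q w p a :=
  Finset.measurable_sum _ fun x _ =>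
    ((hw.measurable a x).comp measurable_fst).mul ((hQ.measurable x).comp measurable_snd)

theorem IsJointDensity.integrable_outputDensity [SigmaFinite ρ] [SigmaFinite ν]
    (hw : IsJointDensity ρ w) (hQ : IsChannel ν Q) (a : A) :
    Integrable (fun p => outputDensity Q w p a) (ρ.prod ν) :=
  integrable_finsetSum _ fun x _ => (hw.integrable a x).mul_prod (hQ.integrable x)

theorem IsJointDensity.outputDensity_nonneg (hw : IsJointDensity ρ w) (hQ : IsChannel ν Q)
    (p : U × B) (a : A) : 0 ≤ outputDensity Q w p a :=
  Finset.sum_nonneg fun x _ => mul_nonneg (hw.nonneg a _ x) (hQ.nonneg x _)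

variable [Fintype A]

theorem IsJointDensity.integrable_entropyFn [SigmaFinite ρ] [SigmaFinite ν]
    (hw : IsJointDensity ρ w) (hQ : IsChannel ν Q) :
    Integrable (fun p => entropyFn (outputDensity Q w p)) (ρ.prod ν) := by
  refine ((integrable_finsetSum Finset.univ fun a _ =>
    hw.integrable_outputDensity hQ a).mul_const (Real.log (Fintype.card A))).mono'
    (continuous_entropyFn.measurable.comp (measurable_pi_lambda _ fun a =>
      hw.measurable_outputDensity hQ a)).aestronglyMeasurable (ae_of_all _ fun p => ?_)
  rw [Real.norm_eq_abs, abs_of_nonneg (entropyFn_nonneg (hw.outputDensity_nonneg hQ p))]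
  exact entropyFn_le_log_card (hw.outputDensity_nonneg hQ p)

theorem IsJointDensity.condEntropy_eq [SigmaFinite ρ] [SigmaFinite ν]
    (hw : IsJointDensity ρ w) (hQ : IsChannel ν Q) :
    condEntropy ρ ν Q w = ∫ u, ∫ b, entropyFn (fun a => ∑ x, w a u x * Q x b) ∂ν ∂ρ :=
  integral_prod _ (hw.integrable_entropyFn hQ)

end CondEntropy

instance sigmaFinite_blockMeasure {B : Type*} [MeasurableSpace B] (n : ℕ) (ν : Measure B) [SigmaFinite ν] :
    SigmaFinite (blockMeasure n ν) := by
  unfold blockMeasure; infer_instance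

/-! ### Passing part of the channel input to the side information -/

section SideInfo

variable {A U K J B : Type*} [MeasurableSpace U] [MeasurableSpace B] [Fintype J]
  {ρ : Measure U} {ν : Measure B} {v : A → U → K → J → ℝ} {Q : J → B → ℝ}

/-- Sends the second part `j` of the channel input `(k, j)` through `Q` and appends the output to
the side information. -/
def appendOutput (Q : J → B → ℝ) (v : A → U → K → J → ℝ) : A → U × B → K → ℝ :=
  fun a p k => ∑ j, v a p.1 k j * Q j p.2

theorem IsJointDensity.appendOutput [SigmaFinite ρ] [SigmaFinite ν]
    (hv : ∀ k, IsJointDensity ρ fun a u j => v a u k j) (hQ : IsChannel ν Q) :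
    IsJointDensity (ρ.prod ν) (appendOutput Q v) where
  nonneg a p k := (hv k).outputDensity_nonneg hQ p a
  measurable a k := (hv k).measurable_outputDensity hQ a
  integrable a k := (hv k).integrable_outputDensity hQ a

theorem totalMass_appendOutput [Fintype A] [Fintype K] [SigmaFinite ρ] [SigmaFinite ν]
    (hv : ∀ k, IsJointDensity ρ fun a u j => v a u k j) (hQ : IsChannel ν Q) :
    totalMass (ρ.prod ν) (appendOutput Q v) = ∑ a, ∑ k, ∑ j, ∫ u, v a u k j ∂ρ := by
  refine Finset.sum_congr rfl fun a _ => Finset.sum_congr rfl fun k _ => ?_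
  simp only [Wiretap.appendOutput]
  rw [integral_finsetSum _ fun j _ => ((hv k).integrable a j).mul_prod (hQ.integrable j)]
  refine Finset.sum_congr rfl fun j _ => ?_
  rw [integral_prod_mul (fun u => v a u k j) (Q j), hQ.integral_eq_one, mul_one]

theorem integral_prod_right_comm {B' E : Type*} [MeasurableSpace B'] [NormedAddCommGroup E]
    [NormedSpace ℝ E] {ν' : Measure B'} [SigmaFinite ρ] [SigmaFinite ν] [SigmaFinite ν']
    (g : (U × B) × B' → E) :
    ∫ p, g p ∂((ρ.prod ν).prod ν') =
      ∫ p : (U × B') × B, g ((p.1.1, p.2), p.1.2) ∂((ρ.prod ν').prod ν) := by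
  have h1 := (measurePreserving_prodAssoc ρ ν' ν)
  have h2 := (MeasurePreserving.id ρ).prod (Measure.measurePreserving_swap (μ := ν') (ν := ν))
  have h3 := (measurePreserving_prodAssoc ρ ν ν').symm
  have h := (h3.comp h2).comp h1
  -- Written as a measurable equivalence, the change of variables requires no measurability of `g`.
  let e : (U × B') × B ≃ᵐ (U × B) × B' := (MeasurableEquiv.prodAssoc.trans
    ((MeasurableEquiv.refl U).prodCongr MeasurableEquiv.prodComm)).trans
    MeasurableEquiv.prodAssoc.symm
  have h' : MeasurePreserving e ((ρ.prod ν').prod ν) ((ρ.prod ν).prod ν') := h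
  exact (h'.integral_comp e.measurableEmbedding g).symm

theorem integral_prod_block_succ {E : Type*} [NormedAddCommGroup E] [NormedSpace ℝ E]
    [SigmaFinite ρ] [SigmaFinite ν] {n : ℕ} (g : U × (Fin (n + 1) → B) → E) :
    ∫ p, g p ∂(ρ.prod (blockMeasure (n + 1) ν)) =
      ∫ p : (U × B) × (Fin n → B), g (p.1.1, Fin.cons p.1.2 p.2)
        ∂((ρ.prod ν).prod (blockMeasure n ν)) := by
  have h0 : MeasurePreserving (MeasurableEquiv.piFinSuccAbove (fun _ => B) 0).symm
      (ν.prod (blockMeasure n ν)) (blockMeasure (n + 1) ν) :=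
    (measurePreserving_piFinSuccAbove (fun _ : Fin (n + 1) => ν) 0).symm
  have h1 : MeasurePreserving (MeasurableEquiv.prodAssoc : (U × B) × (Fin n → B) ≃ᵐ _)
      ((ρ.prod ν).prod (Measure.pi fun _ => ν)) (ρ.prod (ν.prod (Measure.pi fun _ => ν))) :=
    measurePreserving_prodAssoc ρ ν (Measure.pi fun _ : Fin n => ν)
  have h := ((MeasurePreserving.id ρ).prod h0).comp h1
  let e : (U × B) × (Fin n → B) ≃ᵐ U × (Fin (n + 1) → B) := MeasurableEquiv.prodAssoc.trans
    ((MeasurableEquiv.refl U).prodCongr (MeasurableEquiv.piFinSuccAbove (fun _ => B) 0).symm)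
  have h' : MeasurePreserving e ((ρ.prod ν).prod (blockMeasure n ν))
    (ρ.prod (blockMeasure (n + 1) ν)) := h
  rw [← h'.integral_comp e.measurableEmbedding g]
  refine integral_congr_ae (ae_of_all _ fun p => ?_)
  change g (p.1.1, (Fin.insertNthEquiv (fun _ => B) 0) (p.1.2, p.2)) = _
  simp [Fin.insertNthEquiv]

end SideInfo

/-! ### Splitting off the first letter of a block -/

theorem sum_fin_cons {X : Type*} [Fintype X] {n : ℕ} (g : (Fin (n + 1) → X) → ℝ) :
    ∑ x, g x = ∑ x₀, ∑ x, g (Fin.cons x₀ x) := by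
  rw [← (Fin.consEquiv fun _ => X).sum_comp, Fintype.sum_prod_type]
  rfl

theorem memoryless_cons {X B : Type*} {n : ℕ} (Q : X → B → ℝ) (x₀ : X) (x : Fin n → X) (b₀ : B)
    (b : Fin n → B) :
    memoryless (n + 1) Q (Fin.cons x₀ x) (Fin.cons b₀ b) = Q x₀ b₀ * memoryless n Q x b := by
  simp [memoryless, Fin.prod_univ_succ]

section BlockEntropy

variable {A U X B : Type*} [Fintype A] [Fintype X] [MeasurableSpace U] [MeasurableSpace B]
  {ρ : Measure U} {ν : Measure B} [SigmaFinite ρ] [SigmaFinite ν] {n : ℕ}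

/-- The first output letter becomes side information. -/
theorem condEntropy_block_succ (Q : X → B → ℝ) (w : A → U → (Fin (n + 1) → X) → ℝ) :
    condEntropy ρ (blockMeasure (n + 1) ν) (memoryless (n + 1) Q) w =
      condEntropy (ρ.prod ν) (blockMeasure n ν) (memoryless n Q)
        (appendOutput Q fun a u x x₀ => w a u (Fin.cons x₀ x)) := by
  rw [condEntropy, integral_prod_block_succ]
  refine integral_congr_ae (ae_of_all _ fun p => congrArg entropyFn (funext fun a => ?_))
  simp only [outputDensity, appendOutput]
  rw [sum_fin_cons, Finset.sum_comm]
  refine Finset.sum_congr rfl fun x _ => ?_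
  rw [Finset.sum_mul]
  exact Finset.sum_congr rfl fun x₀ _ => by rw [memoryless_cons]; ring

/-- Side information and channel output play symmetric roles. -/
theorem condEntropy_appendOutput_comm {K J B' : Type*} [Fintype K] [Fintype J]
    [MeasurableSpace B'] {ν' : Measure B'} [SigmaFinite ν'] (Q : J → B → ℝ) (Q' : K → B' → ℝ)
    (v : A → U → K → J → ℝ) :
    condEntropy (ρ.prod ν) ν' Q' (appendOutput Q v) =
      condEntropy (ρ.prod ν') ν Q (appendOutput Q' fun a u j k => v a u k j) := by
  rw [condEntropy, integral_prod_right_comm]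
  refine integral_congr_ae (ae_of_all _ fun p => congrArg entropyFn (funext fun a => ?_))
  simp only [outputDensity, appendOutput, Finset.sum_mul]
  rw [Finset.sum_comm]
  exact Finset.sum_congr rfl fun j _ => Finset.sum_congr rfl fun k _ => by ring

end BlockEntropy

/-! ### The converse -/

universe uY uZ

section Converse

variable {X : Type*} {Y : Type uY} {Z : Type uZ} [Fintype X] [MeasurableSpace Y]
  [MeasurableSpace Z] {νY : Measure Y} {νZ : Measure Z} {QY : X → Y → ℝ} {QZ : X → Z → ℝ} {C : ℝ}

/-- `C` bounds `I(T;Y) - I(T;Z)` for all finite auxiliary alphabets. -/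
def IsWiretapBound (νY : Measure Y) (νZ : Measure Z) (QY : X → Y → ℝ) (QZ : X → Z → ℝ)
    (C : ℝ) : Prop :=
  ∀ (k : ℕ) (P : Fin k → ℝ) (V : Fin k → X → ℝ), P ∈ stdSimplex ℝ (Fin k) → IsStochastic V →
    mutualInfo νY P (comp V QY) - mutualInfo νZ P (comp V QZ) ≤ C

theorem exists_factorization {A : Type*} [Fintype A] {v : A → X → ℝ} (hv : ∀ a x, 0 ≤ v a x)
    (hS : 0 < ∑ a, ∑ x, v a x) :
    ∃ P ∈ stdSimplex ℝ A, ∃ V : A → X → ℝ, IsStochastic V ∧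
      ∀ a x, v a x = (∑ a, ∑ x, v a x) * (P a * V a x) := by
  classical
  have hX : Nonempty X := by
    by_contra h
    rw [not_nonempty_iff] at h
    simp at hS
  obtain ⟨x₀⟩ := hX
  set S := ∑ a, ∑ x, v a x
  have hr : ∀ a, 0 ≤ ∑ x, v a x := fun a => Finset.sum_nonneg fun x _ => hv a x
  refine ⟨fun a => (∑ x, v a x) / S, ⟨fun a => div_nonneg (hr a) hS.le, ?_⟩,
    -- Rows of zero mass carry no conditional law, so an arbitrary point mass is used there.
    fun a => if ∑ x, v a x = 0 then Pi.single x₀ 1 else fun x => v a x / ∑ x, v a x,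
    fun a => ?_, fun a x => ?_⟩
  · rw [← Finset.sum_div]; exact div_self hS.ne'
  · dsimp only
    split_ifs with h
    · exact single_mem_stdSimplex ℝ x₀
    · exact ⟨fun x => div_nonneg (hv a x) (hr a), by rw [← Finset.sum_div]; exact div_self h⟩
  · dsimp only
    split_ifs with h
    · rw [h, (Finset.sum_eq_zero_iff_of_nonneg fun x _ => hv a x).1 h x (Finset.mem_univ x)]
      simp
    · field_simp

theorem integral_entropyFn_eq_of_factorization {A B : Type*} [Fintype A] [MeasurableSpace B]
    {ν : Measure B} {Q : X → B → ℝ} (hQ : IsChannel ν Q) {P : A → ℝ} (hP : P ∈ stdSimplex ℝ A)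
    {V : A → X → ℝ} (hV : IsStochastic V) {v : A → X → ℝ} {S : ℝ}
    (hv : ∀ a x, v a x = S * (P a * V a x)) :
    ∫ b, entropyFn (fun a => ∑ x, v a x * Q x b) ∂ν =
      S * (entropyFn P - mutualInfo ν P (comp V Q)) := by
  rw [(hQ.comp hV).mutualInfo_eq hP, sub_sub_cancel, ← integral_const_mul]
  refine integral_congr_ae (ae_of_all _ fun b => ?_)
  simp only
  rw [← entropyFn_smul]
  refine congrArg entropyFn (funext fun a => ?_)
  simp only [comp, Finset.mul_sum]
  exact Finset.sum_congr rfl fun x _ => by rw [hv a x]; ring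

/-- After normalization `v` is a joint law of an auxiliary letter and a channel input. The entropy
of the auxiliary letter cancels in the difference, leaving I(T;Y) - I(T;Z) times the mass. -/
theorem IsWiretapBound.integral_entropyFn_sub_le (hC : IsWiretapBound νY νZ QY QZ C)
    (hQY : IsChannel νY QY) (hQZ : IsChannel νZ QZ) {k : ℕ} {v : Fin k → X → ℝ}
    (hv : ∀ a x, 0 ≤ v a x) :
    ∫ z, entropyFn (fun a => ∑ x, v a x * QZ x z) ∂νZ -
      ∫ y, entropyFn (fun a => ∑ x, v a x * QY x y) ∂νY ≤ C * ∑ a, ∑ x, v a x := by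
  have hS0 : 0 ≤ ∑ a, ∑ x, v a x :=
    Finset.sum_nonneg fun a _ => Finset.sum_nonneg fun x _ => hv a x
  rcases hS0.eq_or_lt with h | h
  · have h0 : ∀ a x, v a x = 0 := fun a x => by
      have h1 := (Finset.sum_eq_zero_iff_of_nonneg fun a _ =>
        Finset.sum_nonneg fun x _ => hv a x).1 h.symm a (Finset.mem_univ a)
      exact (Finset.sum_eq_zero_iff_of_nonneg fun x _ => hv a x).1 h1 x (Finset.mem_univ x)
    simp [h0, entropyFn]
  obtain ⟨P, hP, V, hV, hvP⟩ := exists_factorization hv h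
  set S := ∑ a, ∑ x, v a x
  rw [integral_entropyFn_eq_of_factorization hQZ hP hV hvP,
    integral_entropyFn_eq_of_factorization hQY hP hV hvP]
  have := mul_le_mul_of_nonneg_left (hC k P V hP hV) h.le
  linarith

variable [SigmaFinite νY] [SigmaFinite νZ]

/-- The bound holds for each value u of the side information separately, with the slice at u as
unnormalized law; integrating over u gives the total mass. -/
theorem IsWiretapBound.condEntropy_sub_le (hC : IsWiretapBound νY νZ QY QZ C)
    (hQY : IsChannel νY QY) (hQZ : IsChannel νZ QZ) {U : Type*} [MeasurableSpace U]
    {ρ : Measure U} [SigmaFinite ρ] {k : ℕ} {w : Fin k → U → X → ℝ} (hw : IsJointDensity ρ w) :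
    condEntropy ρ νZ QZ w - condEntropy ρ νY QY w ≤ C * totalMass ρ w := by
  have hi : ∀ a, Integrable (fun u => ∑ x, w a u x) ρ := fun a =>
    integrable_finsetSum _ fun x _ => hw.integrable a x
  have hm : totalMass ρ w = ∫ u, ∑ a, ∑ x, w a u x ∂ρ := by
    rw [integral_finsetSum _ fun a _ => hi a]
    exact Finset.sum_congr rfl fun a _ =>
      (integral_finsetSum _ fun x _ => hw.integrable a x).symm
  have iZ : Integrable (fun u => ∫ z, entropyFn (fun a => ∑ x, w a u x * QZ x z) ∂νZ) ρ :=
    (hw.integrable_entropyFn hQZ).integral_prod_left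
  have iY : Integrable (fun u => ∫ y, entropyFn (fun a => ∑ x, w a u x * QY x y) ∂νY) ρ :=
    (hw.integrable_entropyFn hQY).integral_prod_left
  rw [hw.condEntropy_eq hQY, hw.condEntropy_eq hQZ, ← integral_sub iZ iY, hm,
    ← integral_const_mul]
  exact integral_mono (iZ.sub iY) ((integrable_finsetSum _ fun a _ => hi a).const_mul C)
    fun u => hC.integral_entropyFn_sub_le hQY hQZ fun a x => hw.nonneg a u x

/-- Csiszár's sum argument: the output letters of `QY` are replaced by those of `QZ` one by one. -/
theorem IsWiretapBound.condEntropy_block_sub_le (hC : IsWiretapBound νY νZ QY QZ C)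
    (hQY : IsChannel νY QY) (hQZ : IsChannel νZ QZ) {k : ℕ} (n : ℕ) :
    -- The side information stays quantified within the induction because it grows from U to U × Y;
    -- this universe is closed under that product.
    ∀ {U : Type (max uY uZ)} [MeasurableSpace U] {ρ : Measure U} [SigmaFinite ρ]
      {w : Fin k → U → (Fin n → X) → ℝ}, IsJointDensity ρ w →
      condEntropy ρ (blockMeasure n νZ) (memoryless n QZ) w -
        condEntropy ρ (blockMeasure n νY) (memoryless n QY) w ≤ n * C * totalMass ρ w := by
  induction n with
  | zero =>
    intro U _ ρ _ w hw
    rw [hw.condEntropy_eq (hQY.memoryless 0), hw.condEntropy_eq (hQZ.memoryless 0)]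
    simp [memoryless, blockMeasure, measureReal_def]
  | succ n ih =>
    intro U _ ρ _ w hw
    have h1 : ∀ x, IsJointDensity ρ fun a u (x₀ : X) => w a u (Fin.cons x₀ x) := fun x =>
      ⟨fun a u x₀ => hw.nonneg _ _ _, fun a x₀ => hw.measurable _ _, fun a x₀ => hw.integrable _ _⟩
    have h2 : ∀ x₀ : X, IsJointDensity ρ fun a u (x : Fin n → X) => w a u (Fin.cons x₀ x) :=
      fun x₀ => ⟨fun a u x => hw.nonneg _ _ _, fun a x => hw.measurable _ _,
        fun a x => hw.integrable _ _⟩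
    have hY := IsJointDensity.appendOutput h1 hQY
    have hZ := IsJointDensity.appendOutput h2 (hQZ.memoryless n)
    -- With V the current side information and Z' the last n eavesdropper letters, `e1` bounds
    -- H(A|V,Y₁,Z') - H(A|V,Yⁿ⁺¹) and `e2` bounds H(A|V,Z₁,Z') - H(A|V,Y₁,Z'). The mixed term
    -- cancels in the sum.
    have e1 := ih hY
    have e2 := hC.condEntropy_sub_le hQY hQZ hZ
    have m1 : totalMass (ρ.prod νY) (appendOutput QY fun a u x x₀ => w a u (Fin.cons x₀ x)) =
        totalMass ρ w := by
      rw [totalMass_appendOutput h1 hQY]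
      refine Finset.sum_congr rfl fun a _ => ?_
      rw [sum_fin_cons, Finset.sum_comm]
    have m2 : totalMass (ρ.prod (blockMeasure n νZ))
        (appendOutput (memoryless n QZ) fun a u x₀ x => w a u (Fin.cons x₀ x)) =
        totalMass ρ w := by
      rw [totalMass_appendOutput h2 (hQZ.memoryless n)]
      exact Finset.sum_congr rfl fun a _ => by rw [sum_fin_cons]
    rw [condEntropy_block_succ, condEntropy_block_succ,
      condEntropy_appendOutput_comm QZ (memoryless n QZ)]
    rw [condEntropy_appendOutput_comm QY (memoryless n QZ), m1] at e1
    rw [m2] at e2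
    push_cast
    linarith

theorem IsWiretapBound.mutualInfo_sub_leakage_le (hC : IsWiretapBound νY νZ QY QZ C)
    (hQY : IsChannel νY QY) (hQZ : IsChannel νZ QZ) {k n : ℕ} {P : Fin k → ℝ}
    (hP : P ∈ stdSimplex ℝ (Fin k)) {enc : Fin k → (Fin n → X) → ℝ} (henc : IsStochastic enc) :
    mutualInfo (blockMeasure n νY) P (comp enc (memoryless n QY)) -
      mutualInfo (blockMeasure n νZ) P (comp enc (memoryless n QZ)) ≤ n * C := by
  -- The induction starts with trivial side information, a one-point space in the required universe.
  let w : Fin k → PUnit.{max uY uZ + 1} → (Fin n → X) → ℝ := fun a _ x => P a * enc a x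
  let ρ : Measure PUnit.{max uY uZ + 1} := Measure.dirac PUnit.unit
  have hw : IsJointDensity ρ w := ⟨fun a _ x => mul_nonneg (hP.1 a) ((henc a).1 x),
    fun a x => measurable_const, fun a x => integrable_const _⟩
  have hmass : totalMass ρ w = 1 := by
    simp [totalMass, ρ, w, ← Finset.mul_sum, (henc _).2, hP.2]
  have hY : condEntropy ρ (blockMeasure n νY) (memoryless n QY) w =
      ∫ y, entropyFn (fun a => P a * comp enc (memoryless n QY) a y) ∂(blockMeasure n νY) := by
    rw [hw.condEntropy_eq (hQY.memoryless n)]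
    simp [ρ, w, comp, Finset.mul_sum, mul_assoc]
  have hZ : condEntropy ρ (blockMeasure n νZ) (memoryless n QZ) w =
      ∫ z, entropyFn (fun a => P a * comp enc (memoryless n QZ) a z) ∂(blockMeasure n νZ) := by
    rw [hw.condEntropy_eq (hQZ.memoryless n)]
    simp [ρ, w, comp, Finset.mul_sum, mul_assoc]
  have h := hC.condEntropy_block_sub_le hQY hQZ n hw
  rw [hY, hZ, hmass, mul_one] at h
  rw [((hQY.memoryless n).comp henc).mutualInfo_eq hP,
    ((hQZ.memoryless n).comp henc).mutualInfo_eq hP]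
  linarith

end Converse

/-- Fano's inequality. -/
theorem IsChannel.fano {A B : Type*} [Fintype A] [Nonempty A] [MeasurableSpace B] {ν : Measure B}
    {W : A → B → ℝ} (hW : IsChannel ν W) {dec : B → A}
    (hdec : ∀ a, MeasurableSet (dec ⁻¹' {a})) :
    Real.log (Fintype.card A) * (1 - errorProb ν W dec) ≤
      Real.log 2 + mutualInfo ν (uniform A) W := by
  classical
  have hu := uniform_mem_stdSimplex (A := A)
  have hk : (0 : ℝ) < Fintype.card A := by exact_mod_cast Fintype.card_pos
  have hm : ∀ a, MeasurableSet {b | dec b ≠ a} := fun a => (hdec a).compl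
  have hpoint : ∀ b, entropyFn (fun a => uniform A a * W a b) ≤
      ∑ a, uniform A a * (Real.log 2 * W a b + Real.log (Fintype.card A) *
        {b | dec b ≠ a}.indicator (W a) b) := fun b => by
    -- Gibbs with test weights 1/2 on the decoded letter and 1/(2|A|) elsewhere: the cost is log 2,
    -- plus log |A| only on an error.
    refine (entropyFn_le (b := fun a => if dec b = a then 1 / 2 else
      1 / (2 * (Fintype.card A : ℝ))) (fun a => mul_nonneg (hu.1 a) (hW.nonneg a b))
      (fun a => by split_ifs <;> positivity) ?_ ?_).trans (Finset.sum_le_sum fun a _ => ?_)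
    · calc _ ≤ ∑ a, ((if dec b = a then 1 / 2 else 0) + 1 / (2 * (Fintype.card A : ℝ))) := by
            refine Finset.sum_le_sum fun a _ => ?_
            split_ifs
            · have : 0 ≤ 1 / (2 * (Fintype.card A : ℝ)) := by positivity
              linarith
            · linarith
        _ = 1 := by
            rw [Finset.sum_add_distrib, Finset.sum_ite_eq, if_pos (Finset.mem_univ _),
              Finset.sum_const, Finset.card_univ, nsmul_eq_mul]
            field_simp
            norm_num
    · intro a h
      split_ifs at h
      · norm_num at h
      · exact absurd h (by positivity)
    · refine le_of_eq ?_
      by_cases h : dec b = a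
      · have h' : b ∉ {b | dec b ≠ a} := fun hb => hb h
        rw [if_pos h, Set.indicator_of_notMem h', one_div, Real.log_inv]
        ring
      · have h' : b ∈ {b | dec b ≠ a} := h
        rw [if_neg h, Set.indicator_of_mem h', one_div, Real.log_inv,
          Real.log_mul two_ne_zero hk.ne']
        ring
  have hi : ∀ a, Integrable (fun b => uniform A a * (Real.log 2 * W a b +
      Real.log (Fintype.card A) * {b | dec b ≠ a}.indicator (W a) b)) ν := fun a =>
    (((hW.integrable a).const_mul _).add
      (((hW.integrable a).indicator (hm a)).const_mul _)).const_mul _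
  have h := integral_mono (hW.integrable_entropyFn hu.1)
    (integrable_finsetSum _ fun a _ => hi a) hpoint
  have hrhs : ∫ b, ∑ a, uniform A a * (Real.log 2 * W a b +
      Real.log (Fintype.card A) * {b | dec b ≠ a}.indicator (W a) b) ∂ν =
      Real.log 2 + Real.log (Fintype.card A) * errorProb ν W dec := by
    rw [integral_finsetSum _ fun a _ => hi a]
    have h1 : ∀ a, ∫ b, uniform A a * (Real.log 2 * W a b +
        Real.log (Fintype.card A) * {b | dec b ≠ a}.indicator (W a) b) ∂ν =
        uniform A a * Real.log 2 + Real.log (Fintype.card A) *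
          (uniform A a * ∫ b in {b | dec b ≠ a}, W a b ∂ν) := fun a => by
      rw [integral_const_mul, integral_add ((hW.integrable a).const_mul _)
        (((hW.integrable a).indicator (hm a)).const_mul _), integral_const_mul,
        integral_const_mul, hW.integral_eq_one, integral_indicator (hm a)]
      ring
    simp only [h1]
    rw [Finset.sum_add_distrib, ← Finset.sum_mul, hu.2, one_mul, ← Finset.mul_sum]
    rfl
  rw [hrhs] at h
  rw [hW.mutualInfo_eq hu, entropyFn_uniform]
  linarith

/-- Nonnegativity of C covers the case of no achievable rate, where the supremum is 0. -/
theorem IsWiretapBound.capacity_le {X : Type*} {Y : Type uY} {Z : Type uZ} [Fintype X]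
    [MeasurableSpace Y] [MeasurableSpace Z] {νY : Measure Y} {νZ : Measure Z} {QY : X → Y → ℝ}
    {QZ : X → Z → ℝ} {C : ℝ} [SigmaFinite νY] [SigmaFinite νZ]
    (hC : IsWiretapBound νY νZ QY QZ C) (hC0 : 0 ≤ C) (hQY : IsChannel νY QY)
    (hQZ : IsChannel νZ QZ) : capacity νY νZ QY QZ ≤ C := by
  refine Real.sSup_le ?_ hC0
  rintro R ⟨-, k, hk, enc, dec, henc, hdec, herr, hleak, hrate⟩
  refine le_of_forall_lt fun r hr => ?_
  obtain ⟨r', hrr', hr'⟩ := exists_between hr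
  refine hrr'.trans_le ?_
  have hlim : Tendsto (fun n : ℕ => (Real.log 2 + leakage νZ QZ (enc n)) / n + C) atTop
      (𝓝 (0 + C)) :=
    ((tendsto_const_nhds.add hleak).div_atTop tendsto_natCast_atTop_atTop).add_const C
  have hlim2 := (tendsto_const_nhds (x := (1 : ℝ))).sub herr |>.const_mul r'
  rw [zero_add] at hlim
  rw [sub_zero, mul_one] at hlim2
  refine le_of_tendsto_of_tendsto hlim2 hlim ?_
  filter_upwards [hrate r' hr', eventually_gt_atTop 0, herr.eventually_lt_const one_pos]
    with n hn hn0 hε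
  have : Nonempty (Fin (k n)) := ⟨⟨0, hk n⟩⟩
  have hn0' : (0 : ℝ) < n := by exact_mod_cast hn0
  -- With error probability e, n r' (1-e) ≤ (1-e) log |M| ≤ log 2 + I(M;Y) ≤ log 2 + I(M;Z) + n C;
  -- division by n and the limit give r' ≤ C.
  have h1 := ((hQY.memoryless n).comp (henc n)).fano (hdec n)
  have h2 := hC.mutualInfo_sub_leakage_le hQY hQZ (uniform_mem_stdSimplex (A := Fin (k n)))
    (henc n)
  have h3 := mul_le_mul_of_nonneg_right hn.le (sub_pos.2 hε).le
  refine h3.trans ?_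
  rw [div_mul_eq_mul_div, div_add' _ _ _ hn0'.ne', div_le_div_iff_of_pos_right hn0']
  have h4 : leakage νZ QZ (enc n) = mutualInfo (blockMeasure n νZ) (uniform (Fin (k n)))
    (comp (enc n) (memoryless n QZ)) := rfl
  rw [h4]
  linarith

/-! ### The constructed wiretap codes -/

section Construction

theorem IsChannel.errorProb_nonneg {A B : Type*} [Fintype A] [MeasurableSpace B]
    {ν : Measure B} {W : A → B → ℝ} (hW : IsChannel ν W) (dec : B → A) :
    0 ≤ errorProb ν W dec :=
  Finset.sum_nonneg fun a _ => mul_nonneg (by unfold uniform; positivity)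
    (integral_nonneg fun b => hW.nonneg a b)

/-- Hashing the decoded codeword does not increase the error probability. -/
theorem errorProb_hash_le {B L M : Type*} [Fintype L] [Fintype M] [Nonempty L] [Nonempty M]
    [MeasurableSpace B] {ν : Measure B} {W : L → B → ℝ} (hW : IsChannel ν W)
    {F : Finset (L → M)} (hbal : IsBalanced F) {f : L → M} (hf : f ∈ F) (dec : B → L) :
    errorProb ν (fun m b => fiberAvg f (fun l => W l b) m) (fun b => f (dec b)) ≤
      errorProb ν W dec := by
  have h1 : ∀ m, ∫ b in {b | f (dec b) ≠ m}, fiberAvg f (fun l => W l b) m ∂ν =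
      fiberAvg f (fun l => ∫ b in {b | f (dec b) ≠ f l}, W l b ∂ν) m := fun m => by
    simp only [fiberAvg]
    rw [integral_finsetSum _ fun l _ => ((hW.integrable l).const_mul _).integrableOn]
    refine Finset.sum_congr rfl fun l hl => ?_
    rw [integral_const_mul, mem_fiber.1 hl]
  have h2 := hbal.sum_uniform_mul_fiberAvg hf
    (fun l => ∫ b in {b | f (dec b) ≠ f l}, W l b ∂ν) fun _ => 1
  simp only [mul_one] at h2
  simp only [errorProb, h1]
  rw [h2]
  refine Finset.sum_le_sum fun l _ => mul_le_mul_of_nonneg_left ?_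
    (by unfold uniform; positivity)
  -- A wrong hash value forces a wrong decoded codeword.
  exact setIntegral_mono_set (hW.integrable l).integrableOn
    (ae_of_all _ fun b => hW.nonneg l b)
    (LE.le.eventuallyLE fun b hb h => hb (congrArg f h))

theorem measurableSet_preimage_hash {B L M : Type*} [Fintype L] [MeasurableSpace B]
    {dec : B → L} (hdec : ∀ l, MeasurableSet (dec ⁻¹' {l})) (f : L → M) (m : M) :
    MeasurableSet ((fun b => f (dec b)) ⁻¹' {m}) := by
  have : (fun b => f (dec b)) ⁻¹' {m} = ⋃ l ∈ fiber f m, dec ⁻¹' {l} := by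
    ext b; simp [mem_fiber]
  rw [this]
  exact Finset.measurableSet_biUnion _ fun l _ => hdec l

theorem tendsto_condLeakage {T X Z : Type*} [Fintype T] [Nonempty T] [Fintype X]
    [MeasurableSpace Z] {ν : Measure Z} [SigmaFinite ν] {V : T → X → ℝ} {Q : X → Z → ℝ}
    (hV : IsStochastic V) (hQ : IsChannel ν Q)
    {L M : ℕ → Type*} [∀ n, Fintype (L n)] [∀ n, Nonempty (L n)]
    [∀ n, Fintype (M n)] [∀ n, Nonempty (M n)] {μ : ∀ n, L n → (Fin n → T)}
    {F : ∀ n, Finset (L n → M n)} (hF : ∀ n, IsTwoUniversal (F n))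
    (hbal : ∀ n, IsBalanced (F n)) {P : T → ℝ}
    (hmax : IsMaxOn (fun P => mutualInfo ν P (comp V Q)) (stdSimplex ℝ T) P) {δ : ℝ}
    (hδ : 0 < δ)
    (hrate : ∀ᶠ n : ℕ in atTop, Real.log (Fintype.card (M n)) <
      Real.log (Fintype.card (L n)) - n * (mutualInfo ν P (comp V Q) + δ)) :
    Tendsto (fun n => condLeakage ν V Q (μ n) (F n)) atTop (𝓝 0) := by
  have hW := hQ.comp hV
  set K : ℝ := 64 * (1 + Fintype.card T) with hK
  have hK0 : 0 < K := by positivity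
  -- A single s for all n, with K s ≤ δ/2. The rate gap contributes -s n (I + δ) to the exponent and
  -- φ at most s n (I + δ/2), leaving -s n δ/2.
  obtain ⟨s, hs0, hs⟩ := exists_between (lt_min (by norm_num : (0 : ℝ) < 1 / 3)
    (div_pos hδ (mul_pos two_pos hK0)))
  have hs3 : s ≤ 1 / 3 := (hs.trans_le (min_le_left _ _)).le
  have hs1 : s < 1 := by linarith
  have hsK : K * s ≤ δ / 2 := by
    have := (hs.trans_le (min_le_right _ _)).le
    rw [le_div_iff₀ (mul_pos two_pos hK0)] at this
    linarith
  obtain ⟨P₁, hP₁, hmax₁⟩ := hW.exists_isMaxOn_phi hs0 hs1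
  have hphi : phi ν s (comp V Q) P₁ ≤ s * (mutualInfo ν P (comp V Q) + δ / 2) := by
    refine (hW.phi_le hs0 hs3 hP₁).trans (mul_le_mul_of_nonneg_left ?_ hs0.le)
    have : mutualInfo ν P₁ (comp V Q) ≤ mutualInfo ν P (comp V Q) := hmax hP₁
    linarith
  have hlim : Tendsto (fun n : ℕ => Real.exp (-(s * δ / 2 * n)) / s) atTop (𝓝 0) := by
    rw [← zero_div s]
    refine Tendsto.div_const (Real.tendsto_exp_neg_atTop_nhds_zero.comp
      (tendsto_natCast_atTop_atTop.const_mul_atTop (by positivity))) s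
  refine squeeze_zero' (Eventually.of_forall fun n => condLeakage_nonneg hV hQ (hbal n)) ?_ hlim
  filter_upwards [hrate] with n hn
  refine (condLeakage_le hV hQ (hF n) (hbal n) hs0 hs1 hP₁ hmax₁).trans ?_
  have hL0 : (0 : ℝ) < Fintype.card (L n) := by exact_mod_cast Fintype.card_pos
  have hM0 : (0 : ℝ) < Fintype.card (M n) := by exact_mod_cast Fintype.card_pos
  rw [div_le_div_iff₀ (mul_pos hs0 (Real.rpow_pos_of_pos hL0 s)) hs0,
    Real.rpow_def_of_pos hL0, Real.rpow_def_of_pos hM0, ← Real.exp_add, mul_left_comm,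
    mul_comm (Real.exp _) s, ← Real.exp_add]
  refine mul_le_mul_of_nonneg_left (Real.exp_le_exp.2 ?_) hs0.le
  have h1 := mul_le_mul_of_nonneg_left hphi (Nat.cast_nonneg (α := ℝ) n)
  have h2 := mul_le_mul_of_nonneg_left hn.le hs0.le
  linarith

/-- A one-letter auxiliary alphabet carries no information, so the maximum is at least 0. -/
theorem AttainsWiretapMax.nonneg {T X Y Z : Type*} [Fintype T] [Fintype X]
    [MeasurableSpace Y] [MeasurableSpace Z] {νY : Measure Y} {νZ : Measure Z} {QY : X → Y → ℝ}
    {QZ : X → Z → ℝ} {P : T → ℝ} {V : T → X → ℝ} (h : AttainsWiretapMax νY νZ QY QZ P V)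
    {v : X → ℝ} (hv : v ∈ stdSimplex ℝ X) :
    0 ≤ mutualInfo νY P (comp V QY) - mutualInfo νZ P (comp V QZ) := by
  refine le_trans ?_ (h 1 (uniform (Fin 1)) (fun _ => v) uniform_mem_stdSimplex fun _ => hv)
  have hlog : ∀ x : ℝ, Real.log (x / x) = 0 := fun x => by
    rcases eq_or_ne x 0 with h | h <;> simp [h]
  simp [mutualInfo, uniform, hlog]

end Construction

end Wiretap

/-! ### Assembly of the three claims -/

open Wiretap in
theorem mainTheorem3
    {𝒯 𝒳 𝒴 𝒵 : Type*} [Fintype 𝒯] [Nonempty 𝒯] [Fintype 𝒳]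
    [MeasurableSpace 𝒴] [MeasurableSpace 𝒵]
    (νY : Measure 𝒴) [SigmaFinite νY] (νZ : Measure 𝒵) [SigmaFinite νZ]
    -- the channels to the receiver and to the eavesdropper, and the artificial channel
    (QY : 𝒳 → 𝒴 → ℝ) (hQY : IsChannel νY QY)
    (QZ : 𝒳 → 𝒵 → ℝ) (hQZ : IsChannel νZ QZ)
    (QX : 𝒯 → 𝒳 → ℝ) (hQX : IsStochastic QX)
    -- message sets, the channel encoder and the hash family for each block length
    (𝓛 𝓜 : ℕ → Type*) [∀ n, Fintype (𝓛 n)] [∀ n, Nonempty (𝓛 n)]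
    [∀ n, Fintype (𝓜 n)] [∀ n, Nonempty (𝓜 n)]
    (μA : ∀ n, 𝓛 n → (Fin n → 𝒯))
    (𝓕 : ∀ n, Finset (𝓛 n → 𝓜 n))
    (hF : ∀ n, IsTwoUniversal (𝓕 n)) (hbal : ∀ n, IsBalanced (𝓕 n)) :
    -- the bound on the eavesdropped information
    (∀ s : ℝ, 0 < s → s ≤ 1 / 2 →
      (∃ P ∈ stdSimplex ℝ 𝒯, IsMaxOn (phi νZ s (comp QX QZ)) (stdSimplex ℝ 𝒯) P) ∧
      ∀ P₁ ∈ stdSimplex ℝ 𝒯, IsMaxOn (phi νZ s (comp QX QZ)) (stdSimplex ℝ 𝒯) P₁ →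
        ∀ n : ℕ, condLeakage νZ QX QZ (μA n) (𝓕 n) ≤
          (Fintype.card (𝓜 n) : ℝ) ^ s * Real.exp (n * phi νZ s (comp QX QZ) P₁) /
            (s * (Fintype.card (𝓛 n) : ℝ) ^ s)) ∧
    (∃ P ∈ stdSimplex ℝ 𝒯,
      IsMaxOn (fun P => mutualInfo νZ P (comp QX QZ)) (stdSimplex ℝ 𝒯) P) ∧
    ∀ Pmax ∈ stdSimplex ℝ 𝒯,
      IsMaxOn (fun P => mutualInfo νZ P (comp QX QZ)) (stdSimplex ℝ 𝒯) Pmax →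
      ∀ δ : ℝ, 0 < δ →
      (∀ᶠ n : ℕ in atTop, Real.log (Fintype.card (𝓜 n)) <
        Real.log (Fintype.card (𝓛 n)) - n * (mutualInfo νZ Pmax (comp QX QZ) + δ)) →
      -- strong secrecy
      Tendsto (fun n => condLeakage νZ QX QZ (μA n) (𝓕 n)) atTop (𝓝 0) ∧
      -- the wiretap capacity is achieved, up to the rate loss `δ'`, by the constructed codes
      (AttainsWiretapMax νY νZ QY QZ Pmax QX →
        ∀ μB : ∀ n, (Fin n → 𝒴) → 𝓛 n, (∀ n l, MeasurableSet (μB n ⁻¹' {l})) →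
        Tendsto (fun n => errorProb (blockMeasure n νY)
          (fun l => memoryless n (comp QX QY) (μA n l)) (μB n)) atTop (𝓝 0) →
        RateAtLeast 𝓛 (mutualInfo νY Pmax (comp QX QY)) →
        ∀ δ' : ℝ,
        (∀ ε : ℝ, 0 < ε → ∀ᶠ n : ℕ in atTop, Real.log (Fintype.card (𝓛 n)) -
          n * (mutualInfo νZ Pmax (comp QX QZ) + δ' + ε) ≤ Real.log (Fintype.card (𝓜 n))) →
        ∃ f : ∀ n, 𝓛 n → 𝓜 n, (∀ n, f n ∈ 𝓕 n) ∧
          AchievesRate νY νZ QY QZ 𝓜 (fun n => hashEncoder QX (μA n) (f n))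
            (fun n y => f n (μB n y)) (capacity νY νZ QY QZ - δ')) := by
  have hWZ := hQZ.comp hQX
  have hWY := hQY.comp hQX
  refine ⟨fun s hs0 hs1 => ⟨hWZ.exists_isMaxOn_phi hs0 (by linarith),
    fun P₁ hP₁ hmax n => condLeakage_le hQX hQZ (hF n) (hbal n) hs0 (by linarith) hP₁ hmax⟩,
    hWZ.exists_isMaxOn_mutualInfo, fun Pmax hPmax hmax δ hδ hrate => ?_⟩
  have hsecret : Tendsto (fun n => condLeakage νZ QX QZ (μA n) (𝓕 n)) atTop (𝓝 0) :=
    tendsto_condLeakage hQX hQZ hF hbal hmax hδ hrate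
  refine ⟨hsecret, fun hatt μB hμB herr hL δ' hM => ?_⟩
  -- Derandomization: some hash function leaks no more than the average. Reliability imposes no
  -- further choice, since the error bound holds for every member of the family.
  choose f hf hleak using fun n => exists_leakage_le_condLeakage (ν := νZ) (Q := QZ) (V := QX)
    (μ := μA n) (hF n).1
  have hcap : capacity νY νZ QY QZ ≤
      mutualInfo νY Pmax (comp QX QY) - mutualInfo νZ Pmax (comp QX QZ) :=
    -- Attaining the maximum is by definition being a wiretap bound with C the attained value.
    IsWiretapBound.capacity_le hatt
      (hatt.nonneg (hQX (Classical.arbitrary 𝒯))) hQY hQZ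
  refine ⟨f, hf, fun n => isStochastic_hashEncoder hQX (hbal n) (hf n),
    fun n m => measurableSet_preimage_hash (hμB n) (f n) m, ?_, ?_, fun r hr => ?_⟩
  · refine squeeze_zero (fun n => ?_) (fun n => ?_) herr
    · exact ((hQY.memoryless n).comp
        (isStochastic_hashEncoder hQX (hbal n) (hf n))).errorProb_nonneg _
    · have h := errorProb_hash_le ((hWY.memoryless n).precomp (μA n)) (hbal n) (hf n) (μB n)
      have e : comp (hashEncoder QX (μA n) (f n)) (memoryless n QY) = fun m y =>
          fiberAvg (f n) (fun l => memoryless n (comp QX QY) (μA n l) y) m :=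
        funext fun m => funext fun y => comp_hashEncoder QX QY (μA n) (f n) m y
      rw [e]
      exact h
  · exact squeeze_zero (fun n => leakage_hashEncoder_nonneg hQX hQZ (hbal n) (hf n)) hleak
      hsecret
  -- Half of the gap pays for the loss in the rate of 𝓛, the other half for the loss in |𝓜|/|𝓛|.
  · set ε := (capacity νY νZ QY QZ - δ' - r) / 2 with hε
    have hε0 : 0 < ε := by linarith
    filter_upwards [hM ε hε0, hL (mutualInfo νY Pmax (comp QX QY) - ε) (by linarith),
      eventually_gt_atTop 0] with n h1 h2 hn
    have hn0 : (0 : ℝ) < n := by exact_mod_cast hn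
    rw [lt_div_iff₀ hn0] at h2 ⊢
    have h3 : r * n ≤ (mutualInfo νY Pmax (comp QX QY) - ε) * n -
        n * (mutualInfo νZ Pmax (comp QX QZ) + δ' + ε) := by
      have h4 : r ≤ mutualInfo νY Pmax (comp QX QY) - ε -
          (mutualInfo νZ Pmax (comp QX QZ) + δ' + ε) := by linarith
      have := mul_le_mul_of_nonneg_right h4 hn0.le
      linarith
    linarith
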